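/- Write $\mathbb{R}_+=[0,\infty)$, $\mathbb{R}_{++}=(0,\infty)$; "increasing" and "decreasing" are meant strictly. Let $W_1$ be the set of locally integrable functions $c:\mathbb{R}_+\to\mathbb{R}_+$, and $W_2$ the set of measurable, locally bounded functions $c:\mathbb{R}_+\to\mathbb{R}_+$. Let $\rho\in\mathbb{R}$, let $W$ be a set of functions, and let $u:\mathbb{R}_+^2\to\mathbb{R}\cup\{-\infty\}$, $(c,k)\mapsto u(c,k)$, and $F:\mathbb{R}_+^2\to\mathbb{R}$, $(k,c)\mapsto F(k,c)$. For $\bar k>0$ let $A_{\bar k}$ be the set of pairs $(k,c)$ of functions $\mathbb{R}_+\to\mathbb{R}_+$ such that $c\in W$, $k$ is absolutely continuous on every compact interval, $k(0)=\bar k$, $\dot k(t)=F(k(t),c(t))$ for almost every $t\ge 0$, and $\int_0^\infty e^{-\rho t}u(c(t),k(t))\,dt$ can be defined (possibly as $\pm\infty$). The value function is $$\bar V(\bar k)=\sup\Big\{\int_0^\infty e^{-\rho t}u(c(t),k(t))\,dt\ \Big|\ (k,c)\in A_{\bar k}\Big\},\qquad \bar k>0.$$ Assume the following. 1. $\rho>0$,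 and $W=W_1$ or $W=W_2$. 2. $u$ is continuous and concave on $\mathbb{R}_+^2$, nondecreasing in $(c,k)$ on $\mathbb{R}^2_+$, and on $\mathbb{R}_{++}^2$ it is increasing in $c$ and continuously differentiable; there is $c>0$ with $u(c,0)>-\infty$. 3. $F$ is continuous and concave, $F(0,0)=0$, and $F$ is decreasing in $c$. There exist $d_1>0$ and an increasing $\delta_2:\mathbb{R}_+\to\mathbb{R}_+$ with $\delta_2(0)=0$ and $F(k,c)>-d_1k-\delta_2(c)$ for all $k>0$, $c\ge 0$; if $W=W_1$, then $\delta_2(c)=d_2c$ for all $c\ge0$, for some $d_2\ge 0$. For every $c\ge 0$ there is $k>0$ with $F(k,c)>F(0,c)$. 4. For every $k>0$, $\frac{\partial u}{\partial c}(c,k)$ is decreasing in $c>0$, tends to $+\infty$ as $c\downarrow 0$ and to $0$ as $c\to\infty$, and $\limsup_{c\downarrow 0}\frac{\partial u}{\partial k}(c,k)<+\infty$. 5. There are $k^*>0$, $c^*\ge 0$, $\gamma,\delta,\theta,a>0$, $b\ge 0$, $C\in\mathbb{R}$ such that $F(k,c)-F(k^*,c^*)\le\gamma(k-k^*)-\delta(c-c^*)$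 for all $k,c\ge 0$, $\rho-(1-\theta)\gamma>0$, and $u(c,k)\le a\,u_\theta(c)+b\,u_\theta(k)+C$ for all $c,k>0$, where $u_\theta(x)=\frac{x^{1-\theta}-1}{1-\theta}$ if $\theta\ne 1$ and $u_1(x)=\log x$. Then $\bar V(k)\in\mathbb{R}$ for all $k>0$, and: (i) $\bar V$ is increasing and concave on $\mathbb{R}_{++}$ and satisfies the growth condition $\lim_{T\to\infty}e^{-\rho T}\bar V(k^+(T,\bar k))=0$ for all $\bar k>0$, where $k^+(\cdot,\bar k)$ is the solution on $\mathbb{R}_+$ of $\dot k=F(k,0)$, $k(0)=\bar k$ (that is, $\bar V$ belongs to the class $\mathscr{V}$ of increasing concave functions $V:\mathbb{R}_{++}\to\mathbb{R}$ satisfying this condition); (ii) $\bar V$ is a viscosity solution of the HJB equation $\sup_{c\ge 0}\{F(k,c)V'(k)+u(c,k)\}-\rho V(k)=0$ on $\mathbb{R}_{++}$. That is, $\bar V$ is continuous, and for every $k>0$ and every continuously differentiable $\varphi$ defined on a neighbourhood of $k$ contained in $\mathbb{R}_{++}$ with $\varphi(k)=\bar V(k)$: if $\varphi\le\bar V$ on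 the domain of $\varphi$, then $\sup_{c\ge 0}\{F(k,c)\varphi'(k)+u(c,k)\}-\rho\bar V(k)\le 0$; and if $\varphi\ge\bar V$ on the domain of $\varphi$, then $\sup_{c\ge 0}\{F(k,c)\varphi'(k)+u(c,k)\}-\rho\bar V(k)\ge 0$. -/

import Mathlib

open Set Filter Topology MeasureTheory

noncomputable section

namespace CapitalModel

/-! Conventions. A function on `[0, ∞)` is a function `ℝ → ℝ` of which only the values on
`Ici 0` matter; a function on the closed quadrant is a function of two real variables of which only
the values at nonnegative arguments matter. Utility is `u c k` (consumption first) with values in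
`EReal` (the value `⊤` is excluded by an assumption), technology is `F k c` (capital first).
"Increasing" and "decreasing" are strict. -/

/-- The closed quadrant. -/
def quadrant : Set (ℝ × ℝ) := Ici (0 : ℝ) ×ˢ Ici (0 : ℝ)

/-- The open quadrant. -/
def openQuadrant : Set (ℝ × ℝ) := Ioi (0 : ℝ) ×ˢ Ioi (0 : ℝ)

/-- Nonnegative locally integrable consumption paths on `[0, ∞)`. -/
def W₁ : Set (ℝ → ℝ) :=
  {c | (∀ t, 0 ≤ t → 0 ≤ c t) ∧ LocallyIntegrableOn c (Ici 0) volume}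

/-- Nonnegative, (Lebesgue) measurable, locally bounded consumption paths on `[0, ∞)`. -/
def W₂ : Set (ℝ → ℝ) :=
  {c | (∀ t, 0 ≤ t → 0 ≤ c t) ∧ AEMeasurable c (volume.restrict (Ici 0)) ∧
    ∀ T, 0 ≤ T → ∃ M, ∀ t ∈ Icc 0 T, c t ≤ M}

/-- Discount rate and set of controls. -/
structure ControlAssumption (ρ : ℝ) (W : Set (ℝ → ℝ)) : Prop where
  rho_pos : 0 < ρ
  controls : W = W₁ ∨ W = W₂

/-- Instantaneous utility. -/
structure UtilityAssumption (u : ℝ → ℝ → EReal) : Prop where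
  ne_top : ∀ c k, 0 ≤ c → 0 ≤ k → u c k ≠ ⊤
  continuousOn : ContinuousOn (fun x : ℝ × ℝ => u x.1 x.2) quadrant
  concave : ∀ x ∈ quadrant, ∀ y ∈ quadrant, ∀ a b : ℝ, 0 < a → 0 < b → a + b = 1 →
    (a : EReal) * u x.1 x.2 + (b : EReal) * u y.1 y.2 ≤
      u (a * x.1 + b * y.1) (a * x.2 + b * y.2)
  nondecreasing : ∀ c c' k k', 0 ≤ c → c ≤ c' → 0 ≤ k → k ≤ k' → u c k ≤ u c' k'
  increasing : ∀ c c' k, 0 < c → c < c' → 0 < k → u c k < u c' k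
  contDiffOn : ContDiffOn ℝ 1 (fun x : ℝ × ℝ => (u x.1 x.2).toReal) openQuadrant
  finite_at_zero_capital : ∃ c, 0 < c ∧ u c 0 ≠ ⊥

/-- Technology. -/
structure TechnologyAssumption (W : Set (ℝ → ℝ)) (F : ℝ → ℝ → ℝ) : Prop where
  continuousOn : ContinuousOn (fun x : ℝ × ℝ => F x.1 x.2) quadrant
  concave : ConcaveOn ℝ quadrant (fun x : ℝ × ℝ => F x.1 x.2)
  zero : F 0 0 = 0
  decreasing : ∀ k, 0 ≤ k → StrictAntiOn (fun c => F k c) (Ici 0)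
  lower_bound : ∃ (d₁ : ℝ) (δ₂ : ℝ → ℝ), 0 < d₁ ∧ StrictMonoOn δ₂ (Ici 0) ∧ δ₂ 0 = 0 ∧
    (∀ k c, 0 < k → 0 ≤ c → F k c > -d₁ * k - δ₂ c) ∧
    (W = W₁ → ∃ d₂ : ℝ, 0 ≤ d₂ ∧ ∀ c, 0 ≤ c → δ₂ c = d₂ * c)
  productive : ∀ c, 0 ≤ c → ∃ k, 0 < k ∧ F k c > F 0 c

/-- `∂u/∂c` at `(c, k)`. -/
def partialC (u : ℝ → ℝ → EReal) (c k : ℝ) : ℝ := deriv (fun x => (u x k).toReal) c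

/-- `∂u/∂k` at `(c, k)`. -/
def partialK (u : ℝ → ℝ → EReal) (c k : ℝ) : ℝ := deriv (fun y => (u c y).toReal) k

/-- Marginal utility. -/
structure MarginalUtilityAssumption (u : ℝ → ℝ → EReal) : Prop where
  decreasing : ∀ k, 0 < k → StrictAntiOn (fun c => partialC u c k) (Ioi 0)
  tendsto_zero : ∀ k, 0 < k → Tendsto (fun c => partialC u c k) (𝓝[>] 0) atTop
  tendsto_infty : ∀ k, 0 < k → Tendsto (fun c => partialC u c k) atTop (𝓝 0)
  limsup_lt : ∀ k, 0 < k → limsup (fun c => ((partialK u c k : ℝ) : EReal)) (𝓝[>] 0) < ⊤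

/-- The constant relative risk aversion function. -/
def crra (θ x : ℝ) : ℝ := if θ = 1 then Real.log x else (x ^ (1 - θ) - 1) / (1 - θ)

/-- `(p, q) ∈ ∂F(k, c)`, the subdifferential of the concave function `F` on the closed quadrant. -/
def MemSubdifferential (F : ℝ → ℝ → ℝ) (p q k c : ℝ) : Prop :=
  ∀ k' c', 0 ≤ k' → 0 ≤ c' → F k' c' - F k c ≤ p * (k' - k) + q * (c' - c)

/-- The utility bound together with the bound on the growth of capital. -/
def BoundAssumption (ρ : ℝ) (u : ℝ → ℝ → EReal) (F : ℝ → ℝ → ℝ) : Prop :=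
  ∃ kS cS γ δ θ a b C : ℝ, 0 < kS ∧ 0 ≤ cS ∧ 0 < γ ∧ 0 < δ ∧ 0 < θ ∧ 0 < a ∧ 0 ≤ b ∧
    MemSubdifferential F γ (-δ) kS cS ∧
    ρ - (1 - θ) * γ > 0 ∧
    ∀ c k, 0 < c → 0 < k → u c k ≤ ((a * crra θ c + b * crra θ k + C : ℝ) : EReal)

/-- `k` is nonnegative, absolutely continuous on every compact interval of `[0, ∞)`, starts at `k₀`
and satisfies `k' = F(k, c)` almost everywhere. -/
structure IsTrajectory (F : ℝ → ℝ → ℝ) (k c : ℝ → ℝ) (k₀ : ℝ) : Prop where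
  nonneg : ∀ t, 0 ≤ t → 0 ≤ k t
  absolutelyContinuous : ∀ a b, 0 ≤ a → a ≤ b → AbsolutelyContinuousOnInterval k a b
  initial : k 0 = k₀
  equation : ∀ᵐ t ∂(volume.restrict (Ici (0 : ℝ))), HasDerivAt k (F (k t) (c t)) t

/-- The discounted utility at time `t`. -/
def discounted (ρ : ℝ) (u : ℝ → ℝ → EReal) (k c : ℝ → ℝ) (t : ℝ) : EReal :=
  (Real.exp (-ρ * t) : EReal) * u (c t) (k t)

/-- Integral over `[0, ∞)` of the positive part of discounted utility. -/
def gain (ρ : ℝ) (u : ℝ → ℝ → EReal) (k c : ℝ → ℝ) : ENNReal :=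
  ∫⁻ t in Ici (0 : ℝ), (discounted ρ u k c t).toENNReal

/-- Integral over `[0, ∞)` of the negative part of discounted utility. -/
def loss (ρ : ℝ) (u : ℝ → ℝ → EReal) (k c : ℝ → ℝ) : ENNReal :=
  ∫⁻ t in Ici (0 : ℝ), (-discounted ρ u k c t).toENNReal

/-- The integral of discounted utility can be defined (its value may be `±∞`). -/
def PayoffDefined (ρ : ℝ) (u : ℝ → ℝ → EReal) (k c : ℝ → ℝ) : Prop :=
  gain ρ u k c ≠ ⊤ ∨ loss ρ u k c ≠ ⊤

/-- The integral of discounted utility, when it can be defined. -/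
def payoff (ρ : ℝ) (u : ℝ → ℝ → EReal) (k c : ℝ → ℝ) : EReal :=
  (gain ρ u k c : EReal) - (loss ρ u k c : EReal)

/-- The admissible pairs `(k, c)` with `k 0 = k₀`. -/
def admissible (ρ : ℝ) (W : Set (ℝ → ℝ)) (u : ℝ → ℝ → EReal) (F : ℝ → ℝ → ℝ) (k₀ : ℝ) :
    Set ((ℝ → ℝ) × (ℝ → ℝ)) :=
  {x | x.2 ∈ W ∧ IsTrajectory F x.1 x.2 k₀ ∧ PayoffDefined ρ u x.1 x.2}

/-- The value function. -/
def valueFunction (ρ : ℝ) (W : Set (ℝ → ℝ)) (u : ℝ → ℝ → EReal) (F : ℝ → ℝ → ℝ) (k₀ : ℝ) :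
    EReal :=
  sSup ((fun x => payoff ρ u x.1 x.2) '' admissible ρ W u F k₀)

/-- `κ` is the pure accumulation path from `k₀`. -/
def IsPureAccumulationPath (F : ℝ → ℝ → ℝ) (k₀ : ℝ) (κ : ℝ → ℝ) : Prop :=
  IsTrajectory F κ (fun _ => 0) k₀

/-- The growth condition, for every initial stock `k₀ > 0`. The existence of the pure accumulation
path is part of it, so that it is never satisfied for lack of such a path. -/
def GrowthCondition (ρ : ℝ) (F : ℝ → ℝ → ℝ) (V : ℝ → ℝ) : Prop :=
  ∀ k₀, 0 < k₀ → (∃ κ, IsPureAccumulationPath F k₀ κ) ∧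
    ∀ κ, IsPureAccumulationPath F k₀ κ →
      Tendsto (fun T => Real.exp (-ρ * T) * V (κ T)) atTop (𝓝 0)

/-- The class of increasing concave functions on `(0, ∞)` that satisfy the growth condition. -/
structure MemClass (ρ : ℝ) (F : ℝ → ℝ → ℝ) (V : ℝ → ℝ) : Prop where
  increasing : StrictMonoOn V (Ioi 0)
  concave : ConcaveOn ℝ (Ioi 0) V
  growth : GrowthCondition ρ F V

/-- The Hamiltonian `sup_{c ≥ 0} (F(k, c) q + u(c, k))`. -/
def hamiltonian (u : ℝ → ℝ → EReal) (F : ℝ → ℝ → ℝ) (k q : ℝ) : EReal :=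
  ⨆ (c : ℝ) (_ : 0 ≤ c), ((F k c * q : ℝ) : EReal) + u c k

/-- Viscosity subsolution of the HJB equation (sign convention of maximization problems:
test functions from below). -/
structure IsViscositySubsolution (ρ : ℝ) (u : ℝ → ℝ → EReal) (F : ℝ → ℝ → ℝ) (V : ℝ → ℝ) :
    Prop where
  upperSemicontinuousOn : UpperSemicontinuousOn V (Ioi 0)
  inequality : ∀ k, 0 < k → ∀ (U : Set ℝ) (φ : ℝ → ℝ), IsOpen U → k ∈ U → U ⊆ Ioi 0 →
    ContDiffOn ℝ 1 φ U → φ k = V k → (∀ k' ∈ U, φ k' ≤ V k') →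
    hamiltonian u F k (deriv φ k) - ((ρ * V k : ℝ) : EReal) ≤ 0

/-- Viscosity supersolution of the HJB equation (test functions from above). -/
structure IsViscositySupersolution (ρ : ℝ) (u : ℝ → ℝ → EReal) (F : ℝ → ℝ → ℝ) (V : ℝ → ℝ) :
    Prop where
  lowerSemicontinuousOn : LowerSemicontinuousOn V (Ioi 0)
  inequality : ∀ k, 0 < k → ∀ (U : Set ℝ) (φ : ℝ → ℝ), IsOpen U → k ∈ U → U ⊆ Ioi 0 →
    ContDiffOn ℝ 1 φ U → φ k = V k → (∀ k' ∈ U, φ k' ≥ V k') →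
    hamiltonian u F k (deriv φ k) - ((ρ * V k : ℝ) : EReal) ≥ 0

/-- Viscosity solution of the HJB equation on `(0, ∞)`. -/
structure IsViscositySolution (ρ : ℝ) (u : ℝ → ℝ → EReal) (F : ℝ → ℝ → ℝ) (V : ℝ → ℝ) :
    Prop where
  continuousOn : ContinuousOn V (Ioi 0)
  sub : IsViscositySubsolution ρ u F V
  super : IsViscositySupersolution ρ u F V

end CapitalModel

end

/-!
The value function `V` is studied through two devices.

*Free disposal.* Since `F(k, ·)` decreases continuously to `-∞`, a path `k` with `k' ≤ F(k, c)` is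
the trajectory of a control `c' ≥ c`: the output that `c` leaves unused can be consumed
(`Model.free_disposal`). The control `c'` is a function of `k` and `k'` only. So a lower bound for
`V` needs only a capital path that grows slowly enough, and no differential equation with measurable
coefficients has to be solved (`Model.integral_le_realValue`).

*The budget constraint.* The supporting plane gives `F(k, c) ≤ γ k + B - δ c`, so `k` grows at most
like `exp (γ t)`, and consumption discounted at rate `γ` has a bounded integral
(`Model.budget`). The CRRA bound on utility is dominated by a power `σ < 1` with `σ γ < ρ`,
and the linear majorants of this power turn the budget constraint into a bound on payoffs that grows
like `x ^ σ` in the initial stock `x` (`Model.gain_le`). Hence `V < ∞`, and the growth condition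
follows. A stock that decays towards a small productive level while a constant is consumed shows
`V > -∞`.

Convex combinations of trajectories satisfy the differential inequality, so `V` is concave. As the
slope of `F` in `k` is at least `-d`, an additional stock can be carried along if it decays at rate
`d`, so `V` is nondecreasing.

For the inequality of test functions from below, follow a straight line from `x` whose slope `v` is
less than `F(x, c)` while consuming at least `c`, then an almost optimal control, and differentiate
in the duration of the first phase (`Model.hamiltonian_term_le`). If `V` were not strictly increasing,
it would be constant, equal to `w`, from some stock on; with constants as test functions, utility
would never exceed `ρ w`, while the budget constraint and a tangent of utility keep the payoff over
`[0, 1]` below its share of `w` by a fixed amount (`Model.strictMonoOn_realValue`).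

For the inequality of test functions from above, let `q > 0` be the slope of the test function at
`x`. It is the slope of a tangent of the concave function `V`. If the Hamiltonian at `(x, q)` were
less than `ρ V(x)`, it would remain so for stocks near `x` and a slightly smaller slope `q - η`
(`Model.eventually_hamiltonian_le`). Every path would then lose a fixed amount against `V(x)`: if it
stays near `x` for a fixed time, by the strict inequality; if it leaves before, it does so
downwards, and loses the difference `η` of the slopes times the decrease of the stock, up to discounting. This
also covers controls that are unbounded near time zero.
-/

namespace CapitalModel

/-! ### Paths in integral form -/

/-- `k` is the path on `[0, ∞)` that starts at `x` and has the locally integrable rate of change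
`f`. This is absolute continuity together with `k' = f` almost everywhere, in integral form, which
makes shifts and concatenations of paths immediate. -/
structure HasRate (k f : ℝ → ℝ) (x : ℝ) : Prop where
  integrable : ∀ T, 0 ≤ T → IntervalIntegrable f volume 0 T
  eq : ∀ T, 0 ≤ T → k T = x + ∫ s in (0 : ℝ)..T, f s

namespace HasRate

variable {k f k₁ f₁ k₂ f₂ : ℝ → ℝ} {x x₁ x₂ : ℝ}

theorem zero (h : HasRate k f x) : k 0 = x := by
  simpa using h.eq 0 le_rfl

theorem integrable' (h : HasRate k f x) {a b : ℝ} (ha : 0 ≤ a) (hb : 0 ≤ b) :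
    IntervalIntegrable f volume a b :=
  (h.integrable a ha).symm.trans (h.integrable b hb)

theorem sub_eq (h : HasRate k f x) {a b : ℝ} (ha : 0 ≤ a) (hb : 0 ≤ b) :
    k b - k a = ∫ s in a..b, f s := by
  rw [h.eq a ha, h.eq b hb, ← intervalIntegral.integral_interval_sub_left (h.integrable b hb)
    (h.integrable a ha)]
  ring

theorem continuousOn (h : HasRate k f x) : ContinuousOn k (Ici 0) := by
  intro t ht
  have ht : 0 ≤ t := ht
  have h1 : ContinuousOn (fun T => x + ∫ s in (0 : ℝ)..T, f s) (Icc 0 (t + 1)) := by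
    have := intervalIntegral.continuousOn_primitive_interval' (h.integrable (t + 1) (by linarith))
      (left_mem_uIcc)
    rw [uIcc_of_le (by linarith)] at this
    exact continuousOn_const.add this
  have h2 : ContinuousWithinAt k (Icc 0 (t + 1)) t :=
    (h1.congr fun s hs => h.eq s hs.1) t ⟨ht, by linarith⟩
  refine h2.mono_of_mem_nhdsWithin ?_
  rw [mem_nhdsWithin]
  exact ⟨Iio (t + 1), isOpen_Iio, by simp, fun s hs => ⟨hs.2, hs.1.le⟩⟩

theorem continuous_max (h : HasRate k f x) : Continuous fun t => k (max t 0) :=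
  h.continuousOn.comp_continuous (by fun_prop) fun t => le_max_right t 0

theorem of_absolutelyContinuous (hk : ∀ T, 0 ≤ T → AbsolutelyContinuousOnInterval k 0 T)
    (hd : ∀ᵐ t ∂(volume.restrict (Ici (0 : ℝ))), HasDerivAt k (f t) t) : HasRate k f (k 0) := by
  rw [ae_restrict_iff' measurableSet_Ici] at hd
  have key : ∀ T, 0 ≤ T → ∀ᵐ t ∂(volume.restrict (uIoc 0 T)), deriv k t = f t := by
    intro T hT
    rw [ae_restrict_iff' measurableSet_uIoc]
    filter_upwards [hd] with t ht htm
    rw [uIoc_of_le hT] at htm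
    exact (ht htm.1.le).deriv
  refine ⟨fun T hT => ?_, fun T hT => ?_⟩
  · exact (hk T hT).intervalIntegrable_deriv.congr_ae (key T hT)
  · have := (hk T hT).integral_deriv_eq_sub
    rw [intervalIntegral.integral_congr_ae_restrict (key T hT)] at this
    linarith

theorem absolutelyContinuous (h : HasRate k f x) {a b : ℝ} (ha : 0 ≤ a) (hab : a ≤ b) :
    AbsolutelyContinuousOnInterval k a b := by
  have h1 := (h.integrable b (ha.trans hab)).absolutelyContinuousOnInterval_intervalIntegral
    (c := 0) left_mem_uIcc
  have h2 : AbsolutelyContinuousOnInterval k 0 b := by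
    refine Filter.Tendsto.congr' ?_ h1
    refine Filter.eventually_inf_principal.2 (Filter.Eventually.of_forall fun E hE => ?_)
    refine Finset.sum_congr rfl fun i hi => ?_
    have := hE.1 i hi
    rw [uIcc_of_le (ha.trans hab)] at this
    rw [h.eq _ this.1.1, h.eq _ this.2.1, dist_add_left]
  refine h2.mono ?_
  rw [uIcc_of_le hab, uIcc_of_le (ha.trans hab)]
  exact Icc_subset_Icc_left ha

theorem ae_hasDerivAt (h : HasRate k f x) :
    ∀ᵐ t ∂(volume.restrict (Ici (0 : ℝ))), HasDerivAt k (f t) t := by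
  have h1 : ∀ᵐ t : ℝ, ∀ n : ℕ, t ∈ uIcc (0 : ℝ) n →
      ∀ c ∈ uIcc (0 : ℝ) n, HasDerivAt (fun x => ∫ s in c..x, f s) (f t) t :=
    ae_all_iff.2 fun n => (h.integrable n n.cast_nonneg).ae_hasDerivAt_integral
  rw [ae_restrict_iff' measurableSet_Ici]
  have h0 : ∀ᵐ t : ℝ, t ≠ 0 := by simp [ae_iff, measure_singleton]
  filter_upwards [h1, h0] with t ht ht0 htm
  have htp : 0 < t := lt_of_le_of_ne htm (Ne.symm ht0)
  obtain ⟨n, hn⟩ := exists_nat_ge t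
  have h2 := ht n (by rw [uIcc_of_le (by positivity)]; exact ⟨htm, hn⟩) 0 left_mem_uIcc
  refine (h2.const_add x).congr_of_eventuallyEq ?_
  filter_upwards [Ioi_mem_nhds htp] with s hs
  exact h.eq s hs.le

theorem shift (h : HasRate k f x) {a : ℝ} (ha : 0 ≤ a) :
    HasRate (fun t => k (a + t)) (fun t => f (a + t)) (k a) := by
  refine ⟨fun T hT => ?_, fun T hT => ?_⟩
  · have := (h.integrable' ha (add_nonneg ha hT)).comp_add_left a
    simpa using this
  · have := h.sub_eq ha (add_nonneg ha hT)
    rw [intervalIntegral.integral_comp_add_left (fun t => f t)]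
    simp only [add_zero]
    linarith

theorem concat (h₁ : HasRate k₁ f₁ x) {a : ℝ} (ha : 0 ≤ a) (h₂ : HasRate k₂ f₂ (k₁ a)) :
    HasRate (fun t => if t ≤ a then k₁ t else k₂ (t - a))
      (fun t => if t ≤ a then f₁ t else f₂ (t - a)) x := by
  set f : ℝ → ℝ := fun t => if t ≤ a then f₁ t else f₂ (t - a) with hf
  have e1 : ∀ T, 0 ≤ T → T ≤ a → ∀ t ∈ uIoc 0 T, f₁ t = f t := by
    intro T hT hTa t ht
    rw [uIoc_of_le hT] at ht
    simp [hf, ht.2.trans hTa]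
  have e2 : ∀ T, a ≤ T → ∀ t ∈ uIoc a T, f₂ (t - a) = f t := by
    intro T hT t ht
    rw [uIoc_of_le hT] at ht
    simp [hf, ht.1]
  have i1 : ∀ T, 0 ≤ T → T ≤ a → IntervalIntegrable f volume 0 T := fun T hT hTa =>
    (h₁.integrable T hT).congr (e1 T hT hTa)
  have i2 : ∀ T, a ≤ T → IntervalIntegrable f volume a T := fun T hT => by
    have := (h₂.integrable (T - a) (by linarith)).comp_sub_right a
    simp only [zero_add, sub_add_cancel] at this
    exact this.congr (e2 T hT)
  have s1 : ∀ T, 0 ≤ T → T ≤ a → ∫ s in (0 : ℝ)..T, f s = ∫ s in (0 : ℝ)..T, f₁ s :=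
    fun T hT hTa => (intervalIntegral.integral_congr_ae
      (Eventually.of_forall fun t ht => e1 T hT hTa t ht)).symm
  refine ⟨fun T hT => ?_, fun T hT => ?_⟩
  · rcases le_total T a with hTa | hTa
    · exact i1 T hT hTa
    · exact (i1 a ha le_rfl).trans (i2 T hTa)
  · by_cases hTa : T ≤ a
    · simp only [hTa, if_true]
      rw [s1 T hT hTa, h₁.eq T hT]
    · have hTa' : a ≤ T := (not_le.1 hTa).le
      simp only [hTa, if_false]
      rw [← intervalIntegral.integral_add_adjacent_intervals (i1 a ha le_rfl) (i2 T hTa'),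
        s1 a ha le_rfl, h₂.eq (T - a) (by linarith), h₁.eq a ha,
        ← intervalIntegral.integral_congr_ae (Eventually.of_forall fun t ht => e2 T hTa' t ht),
        intervalIntegral.integral_comp_sub_right (fun t => f₂ t)]
      simp only [sub_self]
      ring

theorem add (h₁ : HasRate k₁ f₁ x₁) (h₂ : HasRate k₂ f₂ x₂) :
    HasRate (fun t => k₁ t + k₂ t) (fun t => f₁ t + f₂ t) (x₁ + x₂) := by
  refine ⟨fun T hT => (h₁.integrable T hT).add (h₂.integrable T hT), fun T hT => ?_⟩
  rw [intervalIntegral.integral_add (h₁.integrable T hT) (h₂.integrable T hT), h₁.eq T hT,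
    h₂.eq T hT]
  ring

theorem const_add (a : ℝ) (h : HasRate k f x) : HasRate (fun t => a + k t) f (a + x) := by
  refine ⟨h.integrable, fun T hT => ?_⟩
  rw [h.eq T hT]
  ring

theorem const_mul (a : ℝ) (h : HasRate k f x) :
    HasRate (fun t => a * k t) (fun t => a * f t) (a * x) := by
  refine ⟨fun T hT => (h.integrable T hT).const_mul a, fun T hT => ?_⟩
  rw [intervalIntegral.integral_const_mul, h.eq T hT]
  ring

theorem of_hasDerivAt (hd : ∀ t, HasDerivAt k (f t) t) (hf : Continuous f) :
    HasRate k f (k 0) := by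
  refine ⟨fun T _ => hf.intervalIntegrable _ _, fun T _ => ?_⟩
  rw [intervalIntegral.integral_eq_sub_of_hasDerivAt (fun t _ => hd t) (hf.intervalIntegrable _ _)]
  ring

theorem exp_decay (z d : ℝ) :
    HasRate (fun t => z * Real.exp (-d * t)) (fun t => -d * (z * Real.exp (-d * t))) z := by
  have := HasRate.of_hasDerivAt (k := fun t => z * Real.exp (-d * t))
    (f := fun t => -d * (z * Real.exp (-d * t))) (fun t => ?_) (by fun_prop)
  · simpa using this
  · have h1 : HasDerivAt (fun t : ℝ => Real.exp (-d * t)) (Real.exp (-d * t) * (-d)) t := by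
      simpa using ((hasDerivAt_id t).const_mul (-d)).exp
    convert! h1.const_mul z using 1
    ring

/-- The rate of change of a discounted path. -/
theorem exp_mul (h : HasRate k f x) (a : ℝ) :
    HasRate (fun t => Real.exp (-a * t) * k t)
      (fun t => Real.exp (-a * t) * (f t - a * k t)) x := by
  have hc : ContDiff ℝ 1 fun t : ℝ => Real.exp (-a * t) := by fun_prop
  have h0 := HasRate.of_absolutelyContinuous (k := fun t => Real.exp (-a * t) * k t)
    (f := fun t => Real.exp (-a * t) * (f t - a * k t))
    (fun T hT => (hc.contDiffOn.absolutelyContinuousOnInterval).mul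
      (h.absolutelyContinuous le_rfl hT)) ?_
  · simpa [h.zero] using h0
  · filter_upwards [h.ae_hasDerivAt] with t ht
    have h1 : HasDerivAt (fun t : ℝ => Real.exp (-a * t)) (Real.exp (-a * t) * (-a)) t := by
      simpa using ((hasDerivAt_id t).const_mul (-a)).exp
    convert! h1.mul ht using 1
    ring

theorem sub_le_integral (h : HasRate k f x) {a b : ℝ} {g : ℝ → ℝ} (ha : 0 ≤ a) (hab : a ≤ b)
    (hg : IntervalIntegrable g volume a b) (hf : ∀ᵐ t ∂(volume.restrict (Ioc a b)), f t ≤ g t) :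
    k b - k a ≤ ∫ s in a..b, g s := by
  rw [h.sub_eq ha (ha.trans hab)]
  refine intervalIntegral.integral_mono_ae_restrict hab (h.integrable' ha (ha.trans hab)) hg ?_
  rwa [Measure.restrict_congr_set Ioc_ae_eq_Icc] at hf

end HasRate

/-! ### Consequences of the assumptions -/

theorem crra_le {θ σ : ℝ} (hσ : 0 < σ) (hσθ : 1 - θ < σ) :
    ∃ D, 0 ≤ D ∧ ∀ x, 0 < x → crra θ x ≤ D * (1 + x ^ σ) := by
  rcases lt_trichotomy θ 1 with h | h | h
  · have h1 : 0 < 1 - θ := by linarith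
    refine ⟨1 / (1 - θ), by positivity, fun x hx => ?_⟩
    have h2 : x ^ (1 - θ) ≤ 1 + x ^ σ := by
      rcases le_total x 1 with hx1 | hx1
      · linarith [Real.rpow_le_one hx.le hx1 h1.le, Real.rpow_nonneg hx.le σ]
      · linarith [Real.rpow_le_rpow_of_exponent_le hx1 hσθ.le]
    rw [crra, if_neg h.ne, div_mul_eq_mul_div, one_mul]
    gcongr
    linarith
  · refine ⟨1 / σ, by positivity, fun x hx => ?_⟩
    rw [crra, if_pos h, div_mul_eq_mul_div, one_mul]
    refine (Real.log_le_rpow_div hx.le hσ).trans ?_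
    gcongr
    linarith
  · have h1 : 0 < θ - 1 := by linarith
    refine ⟨1 / (θ - 1), by positivity, fun x hx => ?_⟩
    rw [crra, if_neg h.ne', ← neg_div_neg_eq, div_mul_eq_mul_div, one_mul, neg_sub, neg_sub]
    gcongr
    linarith [Real.rpow_nonneg hx.le (1 - θ), Real.rpow_nonneg hx.le σ]

/-- The assumptions in the form in which they are used, with explicit constants: `F` lies below the
affine function `γ k + B - δ c`, the slope of `F` in `k` is at least `-d`, and utility grows at most
like `c ^ σ + k ^ σ` for an exponent `σ < 1` that is small enough for the discounted integral of the
bound to converge along paths of growth rate `γ`. -/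
structure Model (ρ : ℝ) (W : Set (ℝ → ℝ)) (u : ℝ → ℝ → EReal) (F : ℝ → ℝ → ℝ)
    (γ δ B d σ A : ℝ) : Prop where
  control : ControlAssumption ρ W
  util : UtilityAssumption u
  tech : TechnologyAssumption W F
  γ_pos : 0 < γ
  δ_pos : 0 < δ
  B_nonneg : 0 ≤ B
  d_pos : 0 < d
  σ_pos : 0 < σ
  σ_lt : σ < 1
  σγ_lt : σ * γ < ρ
  A_nonneg : 0 ≤ A
  F_le : ∀ k c, 0 ≤ k → 0 ≤ c → F k c ≤ γ * k + B - δ * c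
  F_slope : ∀ k z c, 0 ≤ k → 0 ≤ z → 0 ≤ c → F k c - d * z ≤ F (k + z) c
  u_le : ∀ c k, 0 ≤ c → 0 ≤ k → u c k ≤ ((A * (1 + c ^ σ + k ^ σ) : ℝ) : EReal)
  F_cont : Continuous fun p : ℝ × ℝ => F (max p.1 0) (max p.2 0)
  u_cont : Continuous fun p : ℝ × ℝ => u (max p.1 0) (max p.2 0)

theorem TechnologyAssumption.concave_coord {W : Set (ℝ → ℝ)} {F : ℝ → ℝ → ℝ}
    (h : TechnologyAssumption W F) {k c k' c' a b : ℝ} (hk : 0 ≤ k) (hc : 0 ≤ c) (hk' : 0 ≤ k')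
    (hc' : 0 ≤ c') (ha : 0 ≤ a) (hb : 0 ≤ b) (hab : a + b = 1) :
    a * F k c + b * F k' c' ≤ F (a * k + b * k') (a * c + b * c') :=
  h.concave.2 (show (k, c) ∈ quadrant from ⟨hk, hc⟩) (show (k', c') ∈ quadrant from ⟨hk', hc'⟩)
    ha hb hab

theorem TechnologyAssumption.slope {W : Set (ℝ → ℝ)} {F : ℝ → ℝ → ℝ}
    (h : TechnologyAssumption W F) :
    ∃ d, 0 < d ∧ ∀ k z c, 0 ≤ k → 0 ≤ z → 0 ≤ c → F k c - d * z ≤ F (k + z) c := by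
  obtain ⟨d, δ₂, hd, -, -, hlow, -⟩ := h.lower_bound
  refine ⟨d, hd, fun k z c hk hz hc => ?_⟩
  by_contra! hlt
  have hz : 0 < z := by
    rcases hz.eq_or_lt with rfl | hz
    · simp at hlt
    · exact hz
  -- A slope below `-d` at one place would persist, and contradict the lower bound far out.
  have key : ∀ w, z ≤ w → w * (F k c - F (k + z) c - d * z) ≤ z * (F k c + d * k + δ₂ c) := by
    intro w hw
    have hw0 : 0 < w := hz.trans_le hw
    have hconc := h.concave_coord hk hc (add_nonneg hk hw0.le) hc
      (div_nonneg (by linarith) hw0.le) (div_nonneg hz.le hw0.le)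
      (show (w - z) / w + z / w = 1 by field_simp; ring)
    have e1 : (w - z) / w * k + z / w * (k + w) = k + z := by field_simp; ring
    have e2 : (w - z) / w * c + z / w * c = c := by field_simp; ring
    rw [e1, e2] at hconc
    have hl := hlow (k + w) c (by linarith) hc
    have : (w - z) * F k c + z * F (k + w) c ≤ w * F (k + z) c := by
      have := mul_le_mul_of_nonneg_left hconc hw0.le
      have e3 : w * ((w - z) / w * F k c + z / w * F (k + w) c)
        = (w - z) * F k c + z * F (k + w) c := by field_simp
      linarith
    nlinarith
  set e := F k c - F (k + z) c - d * z with he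
  have he0 : 0 < e := by linarith
  set R := z * (F k c + d * k + δ₂ c) with hR
  have h1 := key (max z (R / e + 1)) (le_max_left _ _)
  have h2 : (R / e + 1) * e ≤ max z (R / e + 1) * e :=
    mul_le_mul_of_nonneg_right (le_max_right _ _) he0.le
  have h3 : (R / e + 1) * e = R + e := by field_simp
  linarith

theorem UtilityAssumption.continuous_ext {u : ℝ → ℝ → EReal} (h : UtilityAssumption u) :
    Continuous fun p : ℝ × ℝ => u (max p.1 0) (max p.2 0) :=
  h.continuousOn.comp_continuous (f := fun p : ℝ × ℝ => (max p.1 0, max p.2 0)) (by fun_prop)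
    fun p => ⟨le_max_right p.1 0, le_max_right p.2 0⟩

theorem TechnologyAssumption.continuous_ext {W : Set (ℝ → ℝ)} {F : ℝ → ℝ → ℝ}
    (h : TechnologyAssumption W F) :
    Continuous fun p : ℝ × ℝ => F (max p.1 0) (max p.2 0) :=
  h.continuousOn.comp_continuous (f := fun p : ℝ × ℝ => (max p.1 0, max p.2 0)) (by fun_prop)
    fun p => ⟨le_max_right p.1 0, le_max_right p.2 0⟩

theorem exists_model {ρ : ℝ} {W : Set (ℝ → ℝ)} {u : ℝ → ℝ → EReal} {F : ℝ → ℝ → ℝ}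
    (h₁ : ControlAssumption ρ W) (h₂ : UtilityAssumption u) (h₃ : TechnologyAssumption W F)
    (h₅ : BoundAssumption ρ u F) : ∃ γ δ B d σ A, Model ρ W u F γ δ B d σ A := by
  obtain ⟨kS, cS, γ, δ, θ, a, b, C, hkS, hcS, hγ, hδ, hθ, ha, hb, hsub, hρ, hu⟩ := h₅
  obtain ⟨d, hd, hslope⟩ := h₃.slope
  have hρ0 := h₁.rho_pos
  obtain ⟨σ, hσ1, hσ2⟩ := exists_between (show max (1 - θ) 0 < min 1 (ρ / γ) by
    rw [max_lt_iff, lt_min_iff, lt_min_iff, lt_div_iff₀ hγ]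
    exact ⟨⟨by linarith, by linarith⟩, zero_lt_one, by positivity⟩)
  rw [max_lt_iff] at hσ1
  rw [lt_min_iff, lt_div_iff₀ hγ] at hσ2
  obtain ⟨D, hD, hcrra⟩ := crra_le hσ1.2 hσ1.1
  refine ⟨γ, δ, F kS cS - γ * kS + δ * cS, d, σ, 2 * (a + b) * D + |C|, h₁, h₂, h₃, hγ, hδ, ?_, hd,
    hσ1.2, hσ2.1, hσ2.2, by positivity, fun k c hk hc => ?_, hslope, fun c k hc hk => ?_,
    h₃.continuous_ext, h₂.continuous_ext⟩
  · have := hsub 0 0 le_rfl le_rfl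
    rw [h₃.zero] at this
    linarith
  · have := hsub k c hk hc
    linarith
  · have hpow : ∀ x : ℝ, 0 ≤ x → crra θ (x + 1) ≤ D * (2 + x ^ σ) := by
      intro x hx
      have h1 := Real.rpow_add_le_add_rpow hx zero_le_one hσ1.2.le hσ2.1.le
      rw [Real.one_rpow] at h1
      exact (hcrra (x + 1) (by linarith)).trans (mul_le_mul_of_nonneg_left (by linarith) hD)
    refine (h₂.nondecreasing c (c + 1) k (k + 1) hc (by linarith) hk (by linarith)).trans
      ((hu (c + 1) (k + 1) (by linarith) (by linarith)).trans ?_)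
    rw [EReal.coe_le_coe_iff]
    have h3 := mul_le_mul_of_nonneg_left (hpow c hc) ha.le
    have h4 := mul_le_mul_of_nonneg_left (hpow k hk) hb
    have hc' := Real.rpow_nonneg hc σ
    have hk' := Real.rpow_nonneg hk σ
    have h5 : 0 ≤ |C| * (c ^ σ + k ^ σ) := by positivity
    have h6 : 0 ≤ (a + 2 * b) * D * c ^ σ := by positivity
    have h7 : 0 ≤ (2 * a + b) * D * k ^ σ := by positivity
    nlinarith [le_abs_self C]

/-! ### Free disposal -/

variable {ρ γ δ B d σ A : ℝ} {W : Set (ℝ → ℝ)} {u : ℝ → ℝ → EReal} {F : ℝ → ℝ → ℝ}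

theorem locallyIntegrableOn_Ici_iff {f : ℝ → ℝ} :
    LocallyIntegrableOn f (Ici 0) ↔ ∀ T, 0 ≤ T → IntervalIntegrable f volume 0 T := by
  constructor
  · intro h T hT
    rw [intervalIntegrable_iff_integrableOn_Icc_of_le hT]
    exact h.integrableOn_compact_subset Icc_subset_Ici_self isCompact_Icc
  · intro h
    rw [locallyIntegrableOn_iff isClosed_Ici.isLocallyClosed]
    intro K hK hKc
    obtain ⟨b, hb⟩ := hKc.bddAbove
    exact ((intervalIntegrable_iff_integrableOn_Icc_of_le (le_max_right b 0)).1
      (h (max b 0) (le_max_right _ _))).mono_set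
      fun t ht => ⟨hK ht, (hb ht).trans (le_max_left _ _)⟩

theorem ControlAssumption.nonneg (h : ControlAssumption ρ W) {c : ℝ → ℝ} (hc : c ∈ W) {t : ℝ}
    (ht : 0 ≤ t) : 0 ≤ c t := by
  rcases h.controls with rfl | rfl
  · exact hc.1 t ht
  · exact hc.1 t ht

theorem ControlAssumption.locallyIntegrableOn (h : ControlAssumption ρ W) {c : ℝ → ℝ}
    (hc : c ∈ W) : LocallyIntegrableOn c (Ici 0) := by
  rcases h.controls with rfl | rfl
  · exact hc.2
  · rw [locallyIntegrableOn_Ici_iff]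
    intro T hT
    rw [intervalIntegrable_iff_integrableOn_Icc_of_le hT]
    obtain ⟨M, hM⟩ := hc.2.2 T hT
    have : IntegrableOn (fun _ : ℝ => M) (Icc 0 T) := by simp
    refine Integrable.mono' this
      (hc.2.1.mono_measure
        (Measure.restrict_mono Icc_subset_Ici_self le_rfl)).aestronglyMeasurable ?_
    filter_upwards [ae_restrict_mem measurableSet_Icc] with t ht
    rw [Real.norm_of_nonneg (hc.1 t ht.1)]
    exact hM t ht

theorem ControlAssumption.aemeasurable (h : ControlAssumption ρ W) {c : ℝ → ℝ} (hc : c ∈ W) :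
    AEMeasurable c (volume.restrict (Ici 0)) :=
  (h.locallyIntegrableOn hc).aestronglyMeasurable.aemeasurable

/-- A path `k` of rate `f`, with a consumption path `c` that leaves some output unused:
`f ≤ F(k, c)`. For locally bounded controls the rate has to be locally bounded below. No
measurability is asked of `c`, since only the control that uses up the output has to be one of
`W`. -/
structure IsSubpath (W : Set (ℝ → ℝ)) (F : ℝ → ℝ → ℝ) (k c f : ℝ → ℝ) (x : ℝ) : Prop where
  rate : HasRate k f x
  k_nonneg : ∀ t, 0 ≤ t → 0 ≤ k t
  c_nonneg : ∀ t, 0 ≤ t → 0 ≤ c t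
  le : ∀ᵐ t ∂(volume.restrict (Ici (0 : ℝ))), f t ≤ F (k t) (c t)
  bdd : W = W₁ ∨ ∀ T, 0 ≤ T → ∃ M, ∀ᵐ t ∂(volume.restrict (Icc 0 T)), -M ≤ f t

/-- The inverse function of `G t` is measurable in `t` when `G t` is continuous and decreasing to
`-∞` on `[0, ∞)`. -/
theorem measurable_sSup_level {G : ℝ → ℝ → ℝ} {h b : ℝ → ℝ} (hh : Measurable h)
    (hG : ∀ y, 0 ≤ y → Measurable fun t => G t y) (hcont : ∀ t, ContinuousOn (G t) (Ici 0))
    (hanti : ∀ t, StrictAntiOn (G t) (Ici 0)) (hb : ∀ t y, 0 ≤ y → h t ≤ G t y → y ≤ b t) :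
    Measurable (fun t => sSup {y | 0 ≤ y ∧ h t ≤ G t y}) ∧
      (∀ t, 0 ≤ sSup {y | 0 ≤ y ∧ h t ≤ G t y}) ∧
      ∀ t y, 0 ≤ y → h t ≤ G t y → y ≤ sSup {y | 0 ≤ y ∧ h t ≤ G t y} ∧
        G t (sSup {y | 0 ≤ y ∧ h t ≤ G t y}) = h t := by
  set S : ℝ → Set ℝ := fun t => {y | 0 ≤ y ∧ h t ≤ G t y} with hS
  have hbdd : ∀ t, BddAbove (S t) := fun t => ⟨b t, fun y hy => hb t y hy.1 hy.2⟩
  have hnn : ∀ t, 0 ≤ sSup (S t) := fun t => Real.sSup_nonneg fun y hy => hy.1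
  have hlt : ∀ t r, 0 ≤ r → (r < sSup (S t) ↔ h t < G t r) := by
    intro t r hr
    constructor
    · intro hrs
      have hne : (S t).Nonempty := by
        by_contra hne
        rw [not_nonempty_iff_eq_empty] at hne
        rw [hne, Real.sSup_empty] at hrs
        linarith
      obtain ⟨y, hy, hry⟩ := exists_lt_of_lt_csSup hne hrs
      exact hy.2.trans_lt (hanti t hr hy.1 hry)
    · intro hrG
      have hev : ∀ᶠ y in 𝓝[>] r, h t < G t y :=
        ((hcont t r hr).mono (Ioi_subset_Ici hr)).eventually (lt_mem_nhds hrG)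
      obtain ⟨y, hy1, hy2⟩ := (hev.and self_mem_nhdsWithin).exists
      have hy2 : r < y := hy2
      exact hy2.trans_le (le_csSup (hbdd t) ⟨hr.trans hy2.le, hy1.le⟩)
  refine ⟨measurable_of_Ioi fun r => ?_, hnn, fun t y hy hhy => ?_⟩
  · rcases le_or_gt 0 r with hr | hr
    · have : (fun t => sSup (S t)) ⁻¹' Ioi r = {t | h t < G t r} := by
        ext t
        exact hlt t r hr
      rw [this]
      exact measurableSet_lt hh (hG r hr)
    · have : (fun t => sSup (S t)) ⁻¹' Ioi r = univ := by
        ext t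
        simpa using hr.trans_le (hnn t)
      rw [this]
      exact MeasurableSet.univ
  · have hcl : IsClosed (S t) := by
      have : S t = Ici 0 ∩ G t ⁻¹' Ici (h t) := rfl
      rw [this]
      exact (hcont t).preimage_isClosed_of_isClosed isClosed_Ici isClosed_Ici
    have hmem := hcl.csSup_mem ⟨y, hy, hhy⟩ (hbdd t)
    exact ⟨le_csSup (hbdd t) ⟨hy, hhy⟩,
      le_antisymm (not_lt.1 fun hh' => lt_irrefl _ ((hlt t _ (hnn t)).2 hh')) hmem.2⟩

/-- Output that is left unused can be consumed: the same capital path is the trajectory of a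
control that is at least as large. -/
theorem Model.free_disposal (m : Model ρ W u F γ δ B d σ A) {k c f : ℝ → ℝ} {x : ℝ}
    (h : IsSubpath W F k c f x) :
    ∃ c' ∈ W, IsTrajectory F k c' x ∧ ∀ᵐ t ∂(volume.restrict (Ici (0 : ℝ))), c t ≤ c' t := by
  have hfl : LocallyIntegrableOn f (Ici 0) := locallyIntegrableOn_Ici_iff.2 h.rate.integrable
  have hfm : AEMeasurable f (volume.restrict (Ici 0)) := hfl.aestronglyMeasurable.aemeasurable
  have hk0 : ∀ t, 0 ≤ k (max t 0) := fun t => h.k_nonneg _ (le_max_right _ _)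
  have hFy : ∀ t y, 0 ≤ y → F (k (max t 0)) y = F (max (k (max t 0)) 0) (max y 0) := by
    intro t y hy
    rw [max_eq_left hy, max_eq_left (hk0 t)]
  -- The rate is replaced by a measurable version, and the stock is extended to negative times.
  obtain ⟨hmeas, hnn, hprop⟩ := measurable_sSup_level (G := fun t y => F (k (max t 0)) y)
    (h := hfm.mk f) (b := fun t => (γ * k (max t 0) + B - hfm.mk f t) / δ) hfm.measurable_mk
    (fun y hy => by
      simp only [hFy _ y hy]
      have := h.rate.continuous_max
      exact (m.F_cont.comp (this.prodMk (continuous_const (y := y)))).measurable)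
    (fun t => m.tech.continuousOn.comp (f := fun y => (k (max t 0), y)) (by fun_prop)
      fun y hy => ⟨hk0 t, hy⟩)
    (fun t => m.tech.decreasing _ (hk0 t))
    (fun t y hy hhy => by
      rw [le_div_iff₀ m.δ_pos]
      linarith [m.F_le _ y (hk0 t) hy])
  set c₀ : ℝ → ℝ := fun t => sSup {y | 0 ≤ y ∧ hfm.mk f t ≤ F (k (max t 0)) y} with hc₀
  have hae : ∀ᵐ t ∂(volume.restrict (Ici (0 : ℝ))),
      c t ≤ c₀ t ∧ F (k t) (c₀ t) = f t ∧ c₀ t ≤ (γ * k t + B - f t) / δ := by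
    filter_upwards [hfm.ae_eq_mk, h.le, ae_restrict_mem measurableSet_Ici] with t ht1 ht2 ht3
    have ht3 : 0 ≤ t := ht3
    have := hprop t (c t) (h.c_nonneg t ht3) (by rw [← ht1, max_eq_left ht3]; exact ht2)
    rw [← ht1, max_eq_left ht3] at this
    simp only [hc₀, ← ht1, max_eq_left ht3]
    refine ⟨this.1, this.2, ?_⟩
    rw [le_div_iff₀ m.δ_pos]
    have h2 := m.F_le (k t) _ (h.k_nonneg t ht3) (hnn t)
    rw [← ht1, max_eq_left ht3, this.2] at h2
    linarith
  suffices hW : ∃ c' ∈ W, ∀ᵐ t ∂(volume.restrict (Ici (0 : ℝ))), c' t = c₀ t by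
    obtain ⟨c', hc'W, hc'⟩ := hW
    refine ⟨c', hc'W, ⟨h.k_nonneg, fun a b ha hab => h.rate.absolutelyContinuous ha hab,
      h.rate.zero, ?_⟩, ?_⟩
    · filter_upwards [hc', hae, h.rate.ae_hasDerivAt] with t h1 h2 h3
      rwa [h1, h2.2.1]
    · filter_upwards [hc', hae] with t h1 h2
      rw [h1]
      exact h2.1
  have case1 : W = W₁ → ∃ c' ∈ W, ∀ᵐ t ∂(volume.restrict (Ici (0 : ℝ))), c' t = c₀ t := by
    rintro rfl
    refine ⟨c₀, ⟨fun t _ => hnn t, ?_⟩, Eventually.of_forall fun _ => rfl⟩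
    rw [locallyIntegrableOn_Ici_iff]
    intro T hT
    have hkI : IntervalIntegrable k volume 0 T := by
      refine ContinuousOn.intervalIntegrable (h.rate.continuousOn.mono ?_)
      rw [uIcc_of_le hT]
      exact Icc_subset_Ici_self
    have hI : IntervalIntegrable (fun t => (γ * k t + B - f t) / δ) volume 0 T :=
      (((hkI.const_mul γ).add intervalIntegrable_const).sub (h.rate.integrable T hT)).div_const δ
    refine hI.mono_fun' hmeas.aestronglyMeasurable ?_
    rw [uIoc_of_le hT]
    filter_upwards [ae_restrict_of_ae_restrict_of_subset (fun t ht => ht.1.le) hae] with t ht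
    rw [Real.norm_of_nonneg (hnn t)]
    exact ht.2.2
  rcases m.control.controls with hW | hW
  · exact case1 hW
  rcases h.bdd with hW1 | hbdd
  · exact case1 hW1
  -- Local boundedness is required at every time, so the control is set to zero on the null set on
  -- which the lower bounds of the rate fail.
  subst hW
  choose! M hM using hbdd
  have hgood : ∀ᵐ t ∂(volume.restrict (Ici (0 : ℝ))),
      c₀ t ≤ (γ * k t + B - f t) / δ ∧ ∀ n : ℕ, t ≤ n → -M n ≤ f t := by
    rw [eventually_and]
    refine ⟨hae.mono fun t ht => ht.2.2, ae_all_iff.2 fun n => ?_⟩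
    have := hM n n.cast_nonneg
    rw [ae_restrict_iff' measurableSet_Icc] at this
    rw [ae_restrict_iff' measurableSet_Ici]
    filter_upwards [this] with t ht ht0 htn
    exact ht ⟨ht0, htn⟩
  classical
  set c' : ℝ → ℝ := fun t => if c₀ t ≤ (γ * k t + B - f t) / δ ∧ ∀ n : ℕ, t ≤ n → -M n ≤ f t
    then c₀ t else 0 with hc'
  have heq : ∀ᵐ t ∂(volume.restrict (Ici (0 : ℝ))), c' t = c₀ t := by
    filter_upwards [hgood] with t ht
    simp only [hc', if_pos ht]
  refine ⟨c', ⟨fun t _ => ?_, ?_, fun T hT => ?_⟩, heq⟩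
  · simp only [hc']
    split_ifs
    · exact hnn t
    · exact le_rfl
  · exact hmeas.aemeasurable.congr (heq.mono fun t ht => ht.symm)
  · obtain ⟨n, hn⟩ := exists_nat_ge T
    obtain ⟨K, hK⟩ := (isCompact_Icc (a := (0 : ℝ)) (b := T)).bddAbove_image
      (h.rate.continuousOn.mono Icc_subset_Ici_self)
    refine ⟨max 0 ((γ * K + B + M n) / δ), fun t ht => ?_⟩
    simp only [hc']
    split_ifs with hg
    · refine hg.1.trans (le_max_of_le_right ?_)
      have h1 := hg.2 n (ht.2.trans hn)
      have h2 : k t ≤ K := hK (mem_image_of_mem k ht)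
      have h3 := mul_le_mul_of_nonneg_left h2 m.γ_pos.le
      have := m.δ_pos
      gcongr
      linarith
    · exact le_max_left _ _

/-! ### Trajectories -/

theorem IsTrajectory.hasRate {k c : ℝ → ℝ} {x : ℝ} (h : IsTrajectory F k c x) :
    HasRate k (fun t => F (k t) (c t)) x := by
  have := HasRate.of_absolutelyContinuous (fun T hT => h.absolutelyContinuous 0 T le_rfl hT)
    h.equation
  rwa [h.initial] at this

/-- With locally bounded controls the stock cannot fall arbitrarily fast. -/
theorem Model.bdd_rate (m : Model ρ W u F γ δ B d σ A) {k c : ℝ → ℝ}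
    (hkc : ContinuousOn k (Ici 0)) (hk : ∀ t, 0 ≤ t → 0 ≤ k t) (hc : c ∈ W) :
    W = W₁ ∨ ∀ T, 0 ≤ T → ∃ M, ∀ᵐ t ∂(volume.restrict (Icc 0 T)), -M ≤ F (k t) (c t) := by
  rcases m.control.controls with hW | hW
  · exact Or.inl hW
  · refine Or.inr fun T hT => ?_
    subst hW
    obtain ⟨N, hN⟩ := hc.2.2 T hT
    obtain ⟨K, hK⟩ := (isCompact_Icc (a := (0 : ℝ)) (b := T)).bddAbove_image
      (hkc.mono Icc_subset_Ici_self)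
    refine ⟨-(F 0 N - d * K), ?_⟩
    filter_upwards [ae_restrict_mem measurableSet_Icc] with t ht
    have h1 := m.F_slope 0 (k t) (c t) le_rfl (hk t ht.1) (hc.1 t ht.1)
    have h2 : k t ≤ K := hK (mem_image_of_mem k ht)
    have h3 := (m.tech.decreasing 0 le_rfl).antitoneOn (hc.1 t ht.1)
      ((hc.1 t ht.1).trans (hN t ht)) (hN t ht)
    rw [zero_add] at h1
    have := mul_le_mul_of_nonneg_left h2 m.d_pos.le
    linarith

theorem Model.isSubpath (m : Model ρ W u F γ δ B d σ A) {k c : ℝ → ℝ} {x : ℝ}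
    (h : IsTrajectory F k c x) (hc : c ∈ W) :
    IsSubpath W F k c (fun t => F (k t) (c t)) x :=
  ⟨h.hasRate, h.nonneg, fun _ ht => m.control.nonneg hc ht, Eventually.of_forall fun _ => le_rfl,
    m.bdd_rate h.hasRate.continuousOn h.nonneg hc⟩

theorem integral_exp_neg {a : ℝ} (ha : a ≠ 0) (T : ℝ) :
    ∫ t in (0 : ℝ)..T, Real.exp (-a * t) = (1 - Real.exp (-a * T)) / a := by
  rw [intervalIntegral.integral_comp_mul_left (fun t => Real.exp t) (neg_ne_zero.2 ha)]
  simp only [mul_zero, integral_exp, Real.exp_zero, smul_eq_mul]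
  field_simp
  ring

/-- The budget constraint: capital and accumulated consumption, discounted at rate `γ`. -/
theorem Model.budget (m : Model ρ W u F γ δ B d σ A) {k c : ℝ → ℝ} {x : ℝ}
    (h : IsTrajectory F k c x) (hc : c ∈ W) {T : ℝ} (hT : 0 ≤ T) :
    Real.exp (-γ * T) * k T + δ * ∫ t in (0 : ℝ)..T, Real.exp (-γ * t) * c t ≤ x + B / γ := by
  have hcI := locallyIntegrableOn_Ici_iff.1 (m.control.locallyIntegrableOn hc) T hT
  have hγ := m.γ_pos
  have hI1 : IntervalIntegrable (fun t => Real.exp (-γ * t)) volume 0 T :=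
    (by fun_prop : Continuous fun t => Real.exp (-γ * t)).intervalIntegrable _ _
  have hI2 : IntervalIntegrable (fun t => Real.exp (-γ * t) * c t) volume 0 T :=
    hcI.continuousOn_mul (by fun_prop)
  have h1 := (h.hasRate.exp_mul γ).sub_le_integral (g := fun t => B * Real.exp (-γ * t) -
    δ * (Real.exp (-γ * t) * c t)) le_rfl hT ((hI1.const_mul B).sub (hI2.const_mul δ)) ?_
  · rw [intervalIntegral.integral_sub (hI1.const_mul B) (hI2.const_mul δ),
      intervalIntegral.integral_const_mul, intervalIntegral.integral_const_mul,
      integral_exp_neg hγ.ne', h.initial] at h1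
    simp only [mul_zero, Real.exp_zero, one_mul] at h1
    have h2 : B * ((1 - Real.exp (-γ * T)) / γ) ≤ B / γ := by
      rw [mul_div_assoc']
      have := m.B_nonneg
      gcongr
      nlinarith [Real.exp_pos (-γ * T)]
    linarith
  · filter_upwards [ae_restrict_mem measurableSet_Ioc] with t ht
    have := m.F_le (k t) (c t) (h.nonneg t ht.1.le) (m.control.nonneg hc ht.1.le)
    have := mul_le_mul_of_nonneg_left (show F (k t) (c t) - γ * k t ≤ B - δ * c t by linarith)
      (Real.exp_pos (-γ * t)).le
    linarith

theorem Model.integral_consumption_nonneg (m : Model ρ W u F γ δ B d σ A) {c : ℝ → ℝ} (hc : c ∈ W)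
    {T : ℝ} (hT : 0 ≤ T) : 0 ≤ ∫ t in (0 : ℝ)..T, Real.exp (-γ * t) * c t :=
  intervalIntegral.integral_nonneg hT fun _ ht =>
    mul_nonneg (Real.exp_pos _).le (m.control.nonneg hc ht.1)

theorem Model.capital_le (m : Model ρ W u F γ δ B d σ A) {k c : ℝ → ℝ} {x : ℝ}
    (h : IsTrajectory F k c x) (hc : c ∈ W) {T : ℝ} (hT : 0 ≤ T) :
    k T ≤ (x + B / γ) * Real.exp (γ * T) := by
  have h1 := m.budget h hc hT
  have h2 := mul_nonneg m.δ_pos.le (m.integral_consumption_nonneg hc hT)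
  have h3 : Real.exp (-γ * T) * k T ≤ x + B / γ := by linarith
  calc k T = (Real.exp (-γ * T) * k T) * Real.exp (γ * T) := by
        rw [mul_right_comm, ← Real.exp_add]; simp
    _ ≤ _ := by gcongr

theorem Model.integral_consumption_le (m : Model ρ W u F γ δ B d σ A) {k c : ℝ → ℝ} {x : ℝ}
    (h : IsTrajectory F k c x) (hc : c ∈ W) {T : ℝ} (hT : 0 ≤ T) :
    ∫ t in (0 : ℝ)..T, Real.exp (-γ * t) * c t ≤ (x + B / γ) / δ := by
  have h1 := m.budget h hc hT
  have h2 := mul_nonneg (Real.exp_pos (-γ * T)).le (h.nonneg T hT)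
  rw [le_div_iff₀ m.δ_pos]
  linarith

theorem Model.integrable_consumption (m : Model ρ W u F γ δ B d σ A) {k c : ℝ → ℝ} {x : ℝ}
    (h : IsTrajectory F k c x) (hc : c ∈ W) :
    IntegrableOn (fun t => Real.exp (-γ * t) * c t) (Ioi 0) ∧
      ∫ t in Ioi 0, Real.exp (-γ * t) * c t ≤ (x + B / γ) / δ := by
  have hI : ∀ n : ℕ, IntegrableOn (fun t => Real.exp (-γ * t) * c t) (Ioc 0 (n : ℝ)) := by
    intro n
    have := (locallyIntegrableOn_Ici_iff.1 (m.control.locallyIntegrableOn hc) n n.cast_nonneg)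
    have : IntervalIntegrable (fun t => Real.exp (-γ * t) * c t) volume 0 n :=
      this.continuousOn_mul (by fun_prop)
    rwa [intervalIntegrable_iff_integrableOn_Ioc_of_le n.cast_nonneg] at this
  have hint : IntegrableOn (fun t => Real.exp (-γ * t) * c t) (Ioi 0) := by
    refine integrableOn_Ioi_of_intervalIntegral_norm_bounded (l := atTop) ((x + B / γ) / δ) 0 hI
      tendsto_natCast_atTop_atTop (Eventually.of_forall fun n => ?_)
    refine le_trans (le_of_eq ?_) (m.integral_consumption_le h hc n.cast_nonneg)
    refine intervalIntegral.integral_congr fun t ht => ?_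
    rw [uIcc_of_le n.cast_nonneg] at ht
    exact Real.norm_of_nonneg (mul_nonneg (Real.exp_pos _).le (m.control.nonneg hc ht.1))
  refine ⟨hint, ?_⟩
  exact le_of_tendsto (intervalIntegral_tendsto_integral_Ioi 0 hint tendsto_natCast_atTop_atTop)
    (Eventually.of_forall fun n : ℕ => m.integral_consumption_le h hc n.cast_nonneg)

/-! ### Payoffs as Lebesgue integrals of real functions -/

theorem discounted_mono {k c k' c' : ℝ → ℝ} {t : ℝ} (h : u (c t) (k t) ≤ u (c' t) (k' t)) :
    discounted ρ u k c t ≤ discounted ρ u k' c' t :=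
  mul_le_mul_of_nonneg_left h (EReal.coe_nonneg.2 (Real.exp_pos _).le)

theorem coe_le_discounted {k c : ℝ → ℝ} {t m : ℝ} (h : (m : EReal) ≤ u (c t) (k t)) :
    ((Real.exp (-ρ * t) * m : ℝ) : EReal) ≤ discounted ρ u k c t := by
  rw [EReal.coe_mul]
  exact mul_le_mul_of_nonneg_left h (EReal.coe_nonneg.2 (Real.exp_pos _).le)

theorem discounted_le_coe {k c : ℝ → ℝ} {t m : ℝ} (h : u (c t) (k t) ≤ (m : EReal)) :
    discounted ρ u k c t ≤ ((Real.exp (-ρ * t) * m : ℝ) : EReal) := by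
  rw [EReal.coe_mul]
  exact mul_le_mul_of_nonneg_left h (EReal.coe_nonneg.2 (Real.exp_pos _).le)

/-- Finite discounted utility means finite utility. -/
theorem eq_coe_of_discounted {k c : ℝ → ℝ} {t y : ℝ} (h : discounted ρ u k c t = (y : EReal)) :
    u (c t) (k t) = ((Real.exp (ρ * t) * y : ℝ) : EReal) := by
  have h1 : ((Real.exp (ρ * t) : ℝ) : EReal) * discounted ρ u k c t = u (c t) (k t) := by
    rw [discounted, ← mul_assoc, ← EReal.coe_mul, ← Real.exp_add]
    simp
  rw [← h1, h, EReal.coe_mul]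

theorem Model.aemeasurable_discounted (m : Model ρ W u F γ δ B d σ A) {k c : ℝ → ℝ}
    (hk : ContinuousOn k (Ici 0)) (hk0 : ∀ t, 0 ≤ t → 0 ≤ k t) (hc : c ∈ W) :
    AEMeasurable (discounted ρ u k c) (volume.restrict (Ici 0)) := by
  have hkm : AEMeasurable k (volume.restrict (Ici 0)) :=
    (hk.aestronglyMeasurable measurableSet_Ici).aemeasurable
  have h1 : AEMeasurable (fun t => u (max (c t) 0) (max (k t) 0)) (volume.restrict (Ici 0)) :=
    m.u_cont.measurable.comp_aemeasurable ((m.control.aemeasurable hc).prodMk hkm)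
  have h2 : AEMeasurable (fun t : ℝ => ((Real.exp (-ρ * t) : ℝ) : EReal))
      (volume.restrict (Ici 0)) := by
    refine Measurable.aemeasurable (Measurable.coe_real_ereal ?_)
    fun_prop
  refine (h2.mul h1).congr ?_
  filter_upwards [ae_restrict_mem measurableSet_Ici] with t ht
  simp only [Pi.mul_apply, discounted, max_eq_left (m.control.nonneg hc ht), max_eq_left (hk0 t ht)]

/-- An integrable lower bound of discounted utility bounds the payoff from below. -/
theorem coe_integral_le_payoff {k c g : ℝ → ℝ} (hg : IntegrableOn g (Ici 0))
    (hle : ∀ᵐ t ∂(volume.restrict (Ici (0 : ℝ))), (g t : EReal) ≤ discounted ρ u k c t) :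
    ((∫ t in Ici 0, g t : ℝ) : EReal) ≤ payoff ρ u k c := by
  rw [integral_eq_lintegral_pos_part_sub_lintegral_neg_part hg, EReal.coe_sub]
  have h1 : ∫⁻ t in Ici 0, ENNReal.ofReal (g t) ≠ ⊤ :=
    (lt_of_le_of_lt (lintegral_mono fun t => Real.ofReal_le_enorm (g t)) hg.2).ne
  have h2 : ∫⁻ t in Ici 0, ENNReal.ofReal (-g t) ≠ ⊤ :=
    (lt_of_le_of_lt (lintegral_mono fun t => Real.ofReal_le_enorm (-g t)) hg.neg.2).ne
  rw [EReal.coe_ennreal_toReal h1, EReal.coe_ennreal_toReal h2]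
  refine EReal.sub_le_sub (EReal.coe_ennreal_le_coe_ennreal_iff.2 ?_)
    (EReal.coe_ennreal_le_coe_ennreal_iff.2 ?_)
  · refine lintegral_mono_ae (hle.mono fun t ht => ?_)
    rw [← EReal.real_coe_toENNReal]
    exact EReal.toENNReal_le_toENNReal ht
  · refine lintegral_mono_ae (hle.mono fun t ht => ?_)
    rw [← EReal.real_coe_toENNReal, EReal.coe_neg]
    exact EReal.toENNReal_le_toENNReal (EReal.neg_le_neg_iff.2 ht)

/-- A payoff other than `-∞` with finite gain is the integral of a real function. -/
theorem exists_integrable_of_payoff {k c : ℝ → ℝ}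
    (hm : AEMeasurable (discounted ρ u k c) (volume.restrict (Ici 0)))
    (hgain : gain ρ u k c ≠ ⊤) (hpay : payoff ρ u k c ≠ ⊥) :
    ∃ g : ℝ → ℝ, IntegrableOn g (Ici 0) ∧
      (∀ᵐ t ∂(volume.restrict (Ici (0 : ℝ))), discounted ρ u k c t = (g t : EReal)) ∧
      payoff ρ u k c = ((∫ t in Ici 0, g t : ℝ) : EReal) := by
  have hloss : loss ρ u k c ≠ ⊤ := by
    intro h
    refine hpay ?_
    rw [payoff, h]
    simp
  have hneg : AEMeasurable (fun t => -discounted ρ u k c t) (volume.restrict (Ici 0)) :=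
    hm.neg
  have hae : ∀ᵐ t ∂(volume.restrict (Ici (0 : ℝ))),
      discounted ρ u k c t = ((discounted ρ u k c t).toReal : EReal) := by
    filter_upwards [ae_lt_top' hm.ereal_toENNReal hgain, ae_lt_top' hneg.ereal_toENNReal hloss]
      with t h1 h2
    rw [EReal.coe_toReal]
    · intro h
      simp [h] at h1
    · intro h
      simp [h] at h2
  have e1 : gain ρ u k c = ∫⁻ t in Ici 0, ENNReal.ofReal (discounted ρ u k c t).toReal := by
    refine lintegral_congr_ae (hae.mono fun t ht => ?_)
    simp only
    rw [← EReal.real_coe_toENNReal, ← ht]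
  have e2 : loss ρ u k c = ∫⁻ t in Ici 0, ENNReal.ofReal (-(discounted ρ u k c t).toReal) := by
    refine lintegral_congr_ae (hae.mono fun t ht => ?_)
    simp only
    rw [← EReal.real_coe_toENNReal, EReal.coe_neg, ← ht]
  have hint : IntegrableOn (fun t => (discounted ρ u k c t).toReal) (Ici 0) := by
    refine ⟨hm.ereal_toReal.aestronglyMeasurable, ?_⟩
    have : ∀ y : ℝ, ‖y‖ₑ = ENNReal.ofReal y + ENNReal.ofReal (-y) := by
      intro y
      rcases le_total 0 y with hy | hy
      · rw [ENNReal.ofReal_of_nonpos (neg_nonpos.2 hy), add_zero, Real.enorm_of_nonneg hy]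
      · rw [ENNReal.ofReal_of_nonpos hy, zero_add, ← enorm_neg,
          Real.enorm_of_nonneg (neg_nonneg.2 hy)]
    rw [HasFiniteIntegral]
    simp only [this]
    rw [lintegral_add_left' hm.ereal_toReal.ennreal_ofReal, ← e1, ← e2]
    exact ENNReal.add_lt_top.2 ⟨hgain.lt_top, hloss.lt_top⟩
  refine ⟨_, hint, hae, ?_⟩
  rw [integral_eq_lintegral_pos_part_sub_lintegral_neg_part hint, EReal.coe_sub, ← e1, ← e2,
    EReal.coe_ennreal_toReal hgain, EReal.coe_ennreal_toReal hloss]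
  rfl

/-! ### The growth bound on payoffs -/

theorem integrableOn_exp_neg {a : ℝ} (ha : 0 < a) :
    IntegrableOn (fun t : ℝ => Real.exp (-a * t)) (Ioi 0) :=
  integrableOn_exp_mul_Ioi (neg_neg_of_pos ha) 0

theorem integral_Ioi_exp_neg {a : ℝ} (ha : 0 < a) :
    ∫ t in Ioi (0 : ℝ), Real.exp (-a * t) = 1 / a := by
  rw [integral_exp_mul_Ioi (neg_neg_of_pos ha)]
  simp

/-- A power with exponent below one lies below its affine majorants; the constants are not sharp. -/
theorem rpow_le_add {σ c y : ℝ} (hσ0 : 0 < σ) (hσ1 : σ < 1) (hc : 0 ≤ c) (hy : 0 < y) :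
    c ^ σ ≤ y ^ σ + y ^ (σ - 1) * c := by
  rcases le_total c y with h | h
  · have := mul_nonneg (Real.rpow_nonneg hy.le (σ - 1)) hc
    linarith [Real.rpow_le_rpow hc h hσ0.le]
  · have hc0 : 0 < c := hy.trans_le h
    have h1 : c ^ σ = c ^ (σ - 1) * c := by
      rw [Real.rpow_sub_one hc0.ne', div_mul_cancel₀ _ hc0.ne']
    have h2 : c ^ (σ - 1) ≤ y ^ (σ - 1) := Real.rpow_le_rpow_of_nonpos hy h (by linarith)
    rw [h1]
    linarith [mul_le_mul_of_nonneg_right h2 hc, Real.rpow_nonneg hy.le σ]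

/-- The bound on payoffs that are attainable from the stock `x`. -/
noncomputable def payoffBound (ρ γ δ B σ A x : ℝ) : ℝ :=
  A * (1 / ρ + (2 / (ρ - σ * γ) + 1 / δ) * (x + B / γ) ^ σ)

theorem Model.payoffBound_nonneg (m : Model ρ W u F γ δ B d σ A) {x : ℝ} (hx : 0 ≤ x) :
    0 ≤ payoffBound ρ γ δ B σ A x := by
  have := m.control.rho_pos
  have := m.γ_pos
  have := m.δ_pos
  have := m.B_nonneg
  have := m.A_nonneg
  have : 0 < ρ - σ * γ := sub_pos.2 m.σγ_lt
  unfold payoffBound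
  positivity

/-- All gains are bounded, so every payoff is defined. -/
theorem Model.gain_le (m : Model ρ W u F γ δ B d σ A) {k c : ℝ → ℝ} {x : ℝ} (hx : 0 < x)
    (h : IsTrajectory F k c x) (hc : c ∈ W) :
    gain ρ u k c ≤ ENNReal.ofReal (payoffBound ρ γ δ B σ A x) := by
  have hρ := m.control.rho_pos
  have hγ := m.γ_pos
  have hδ := m.δ_pos
  have hA := m.A_nonneg
  have hη : 0 < ρ - σ * γ := sub_pos.2 m.σγ_lt
  set K := x + B / γ with hK
  have hK0 : 0 < K := by have := m.B_nonneg; positivity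
  obtain ⟨hci, hcb⟩ := m.integrable_consumption h hc
  set G : ℝ → ℝ := fun t => A * (Real.exp (-ρ * t) + (2 * K ^ σ * Real.exp (-(ρ - σ * γ) * t) +
    K ^ (σ - 1) * (Real.exp (-γ * t) * c t))) with hG
  have i1 := integrableOn_exp_neg hρ
  have i2 := (integrableOn_exp_neg hη).const_mul (2 * K ^ σ)
  have i3 := hci.const_mul (K ^ (σ - 1))
  have i23 : IntegrableOn (fun t => 2 * K ^ σ * Real.exp (-(ρ - σ * γ) * t) +
    K ^ (σ - 1) * (Real.exp (-γ * t) * c t)) (Ioi 0) := i2.add i3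
  have hGi : IntegrableOn G (Ioi 0) := (i1.add i23).const_mul A
  have hGle : ∫ t in Ioi 0, G t ≤ payoffBound ρ γ δ B σ A x := by
    have e : ∫ t in Ioi 0, G t = A * (1 / ρ + (2 * K ^ σ * (1 / (ρ - σ * γ)) +
        K ^ (σ - 1) * ∫ t in Ioi 0, Real.exp (-γ * t) * c t)) := by
      rw [hG, integral_const_mul, integral_add i1 i23, integral_add i2 i3,
        integral_const_mul, integral_const_mul, integral_Ioi_exp_neg hρ, integral_Ioi_exp_neg hη]
    rw [e, payoffBound, ← hK]
    have h1 : K ^ (σ - 1) * (K / δ) = K ^ σ / δ := by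
      rw [Real.rpow_sub_one hK0.ne']
      field_simp
    have h2 := mul_le_mul_of_nonneg_left hcb (Real.rpow_nonneg hK0.le (σ - 1))
    refine mul_le_mul_of_nonneg_left ?_ hA
    rw [← hK, h1] at h2
    have h3 : (2 / (ρ - σ * γ) + 1 / δ) * K ^ σ = 2 * K ^ σ * (1 / (ρ - σ * γ)) + K ^ σ / δ := by
      ring
    linarith
  have hGnn : ∀ t, 0 ≤ t → 0 ≤ G t := by
    intro t ht
    have := m.control.nonneg hc ht
    simp only [hG]
    positivity
  rw [gain]
  calc ∫⁻ t in Ici (0 : ℝ), (discounted ρ u k c t).toENNReal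
      ≤ ∫⁻ t in Ici (0 : ℝ), ENNReal.ofReal (G t) := by
        refine lintegral_mono_ae ?_
        filter_upwards [ae_restrict_mem measurableSet_Ici] with t ht
        have ht : 0 ≤ t := ht
        have hc0 := m.control.nonneg hc ht
        have hk0 := h.nonneg t ht
        rw [← EReal.real_coe_toENNReal]
        refine EReal.toENNReal_le_toENNReal ((discounted_le_coe (m.u_le _ _ hc0 hk0)).trans ?_)
        rw [EReal.coe_le_coe_iff]
        -- The linear majorant of the power at `y`, whose slope decays at the rate that turns the
        -- discount rate `ρ` into at least `γ`.
        set y := K * Real.exp (γ * t) with hy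
        have hy0 : 0 < y := by positivity
        have h1 := rpow_le_add m.σ_pos m.σ_lt hc0 hy0
        have h2 : k t ^ σ ≤ y ^ σ := Real.rpow_le_rpow hk0 (m.capital_le h hc ht) m.σ_pos.le
        have h3 : Real.exp (-ρ * t) * y ^ σ = K ^ σ * Real.exp (-(ρ - σ * γ) * t) := by
          rw [hy, Real.mul_rpow hK0.le (Real.exp_pos _).le, ← Real.exp_mul, mul_left_comm,
            ← Real.exp_add]
          congr 2
          ring
        have h4 : Real.exp (-ρ * t) * y ^ (σ - 1) ≤ K ^ (σ - 1) * Real.exp (-γ * t) := by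
          rw [hy, Real.mul_rpow hK0.le (Real.exp_pos _).le, ← Real.exp_mul, mul_left_comm,
            ← Real.exp_add]
          refine mul_le_mul_of_nonneg_left (Real.exp_le_exp.2 ?_) (Real.rpow_nonneg hK0.le _)
          nlinarith
        have h5 := mul_le_mul_of_nonneg_right h4 hc0
        have h6 := mul_le_mul_of_nonneg_left (add_le_add h1 h2) (Real.exp_pos (-ρ * t)).le
        have h7 : Real.exp (-ρ * t) * (1 + c t ^ σ + k t ^ σ) ≤ Real.exp (-ρ * t) +
            (2 * K ^ σ * Real.exp (-(ρ - σ * γ) * t) + K ^ (σ - 1) *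
              (Real.exp (-γ * t) * c t)) := by
          linarith
        simp only [hG]
        linarith [mul_le_mul_of_nonneg_left h7 hA]
    _ = ENNReal.ofReal (∫ t in Ici (0 : ℝ), G t) := by
        rw [ofReal_integral_eq_lintegral_ofReal ((integrableOn_Ici_iff_integrableOn_Ioi).2 hGi)]
        filter_upwards [ae_restrict_mem measurableSet_Ici] with t ht using hGnn t ht
    _ ≤ _ := by
        rw [integral_Ici_eq_integral_Ioi]
        exact ENNReal.ofReal_le_ofReal hGle

/-! ### The value function -/

theorem Model.coe_integral_le_value (m : Model ρ W u F γ δ B d σ A) {k c f g : ℝ → ℝ} {x : ℝ}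
    (hx : 0 < x) (h : IsSubpath W F k c f x) (hg : IntegrableOn g (Ici 0))
    (hle : ∀ᵐ t ∂(volume.restrict (Ici (0 : ℝ))), (g t : EReal) ≤ discounted ρ u k c t) :
    ((∫ t in Ici 0, g t : ℝ) : EReal) ≤ valueFunction ρ W u F x := by
  obtain ⟨c', hc', htr, hcc'⟩ := m.free_disposal h
  have hgain : gain ρ u k c' ≠ ⊤ :=
    ((m.gain_le hx htr hc').trans_lt ENNReal.ofReal_lt_top).ne
  refine le_trans (coe_integral_le_payoff (k := k) (c := c') hg ?_)
    (le_sSup ⟨(k, c'), ⟨hc', htr, Or.inl hgain⟩, rfl⟩)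
  filter_upwards [hle, hcc', ae_restrict_mem measurableSet_Ici] with t h1 h2 h3
  exact h1.trans (discounted_mono (m.util.nondecreasing _ _ _ _ (h.c_nonneg t h3) h2
    (h.k_nonneg t h3) le_rfl))

theorem Model.value_le_bound (m : Model ρ W u F γ δ B d σ A) {x : ℝ} (hx : 0 < x) :
    valueFunction ρ W u F x ≤ (payoffBound ρ γ δ B σ A x : EReal) := by
  refine sSup_le ?_
  rintro _ ⟨⟨k, c⟩, ⟨hc, htr, -⟩, rfl⟩
  have h1 := m.gain_le hx htr hc
  calc payoff ρ u k c ≤ (gain ρ u k c : EReal) - 0 :=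
        EReal.sub_le_sub le_rfl (EReal.coe_ennreal_nonneg _)
    _ = (gain ρ u k c : EReal) := by simp
    _ ≤ ((ENNReal.ofReal (payoffBound ρ γ δ B σ A x) : ENNReal) : EReal) :=
        EReal.coe_ennreal_le_coe_ennreal_iff.2 h1
    _ = _ := by rw [EReal.coe_ennreal_ofReal, max_eq_left (m.payoffBound_nonneg hx.le)]

theorem UtilityAssumption.ne_bot (h : UtilityAssumption u) {c k : ℝ} (hc : 0 < c) (hk : 0 < k) :
    u c k ≠ ⊥ := by
  intro h0
  have := h.increasing (c / 2) c k (by linarith) (by linarith) hk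
  rw [h0] at this
  exact not_lt_bot this

/-- Small stocks grow when nothing is consumed. -/
theorem TechnologyAssumption.exists_pos (h : TechnologyAssumption W F) :
    ∃ k₀, 0 < k₀ ∧ ∀ k, 0 < k → k ≤ k₀ → 0 < F k 0 := by
  obtain ⟨k₀, hk₀, hF⟩ := h.productive 0 le_rfl
  rw [h.zero] at hF
  refine ⟨k₀, hk₀, fun k hk hkk => ?_⟩
  have := h.concave_coord (k := k₀) (c := 0) (k' := 0) (c' := 0) hk₀.le le_rfl le_rfl le_rfl
    (div_nonneg hk.le hk₀.le) (sub_nonneg.2 ((div_le_one hk₀).2 hkk))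
    (add_sub_cancel (k / k₀) 1)
  rw [h.zero] at this
  simp only [mul_zero, add_zero, div_mul_cancel₀ _ hk₀.ne'] at this
  exact (mul_pos (div_pos hk hk₀) hF).trans_le this

theorem Model.value_ne_bot (m : Model ρ W u F γ δ B d σ A) {x : ℝ} (hx : 0 < x) :
    valueFunction ρ W u F x ≠ ⊥ := by
  obtain ⟨k₀, hk₀, hpos⟩ := m.tech.exists_pos
  set k₁ := min k₀ x with hk₁
  have hk₁0 : 0 < k₁ := lt_min hk₀ hx
  have hk₁x : k₁ ≤ x := min_le_right _ _
  have hF1 := hpos k₁ hk₁0 (min_le_left _ _)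
  obtain ⟨c₁, hFc, hc₁⟩ : ∃ c₁, 0 < F k₁ c₁ ∧ 0 < c₁ := by
    have hcont : ContinuousOn (fun c => F k₁ c) (Ici 0) :=
      m.tech.continuousOn.comp (f := fun y => (k₁, y)) (by fun_prop) fun y hy => ⟨hk₁0.le, hy⟩
    exact ((((hcont 0 self_mem_Ici).mono Ioi_subset_Ici_self).eventually
      (lt_mem_nhds hF1)).and self_mem_nhdsWithin).exists
  have hd := m.d_pos
  -- A stock that decays towards `k₁` at rate `d` leaves enough output to consume `c₁`.
  set k : ℝ → ℝ := fun t => k₁ + (x - k₁) * Real.exp (-d * t) with hk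
  set f : ℝ → ℝ := fun t => -d * ((x - k₁) * Real.exp (-d * t)) with hf
  have hrate : HasRate k f x := by
    have := (HasRate.exp_decay (x - k₁) d).const_add k₁
    rwa [add_sub_cancel] at this
  have hz : ∀ t, 0 ≤ (x - k₁) * Real.exp (-d * t) := fun t =>
    mul_nonneg (by linarith) (Real.exp_pos _).le
  have hsub : IsSubpath W F k (fun _ => c₁) f x := by
    refine ⟨hrate, fun t _ => by have := hz t; simp only [hk]; linarith, fun _ _ => hc₁.le,
      Eventually.of_forall fun t => ?_, Or.inr fun T _ => ⟨d * (x - k₁), ?_⟩⟩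
    · have := m.F_slope k₁ _ c₁ hk₁0.le (hz t) hc₁.le
      simp only [hk, hf]
      linarith
    · filter_upwards [ae_restrict_mem measurableSet_Icc] with t ht
      have : Real.exp (-d * t) ≤ 1 := Real.exp_le_one_iff.2 (by nlinarith [ht.1])
      simp only [hf]
      nlinarith [mul_le_mul_of_nonneg_left this (mul_nonneg hd.le (sub_nonneg.2 hk₁x))]
  have hu : ((u c₁ k₁).toReal : EReal) = u c₁ k₁ :=
    EReal.coe_toReal (m.util.ne_top _ _ hc₁.le hk₁0.le) (m.util.ne_bot hc₁ hk₁0)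
  have := m.coe_integral_le_value hx hsub (g := fun t => Real.exp (-ρ * t) * (u c₁ k₁).toReal)
    ((integrableOn_Ici_iff_integrableOn_Ioi).2
      ((integrableOn_exp_neg m.control.rho_pos).mul_const _))
    (Eventually.of_forall fun t => coe_le_discounted (by
      rw [hu]
      refine m.util.nondecreasing _ _ _ _ hc₁.le le_rfl hk₁0.le ?_
      have := hz t
      simp only [hk]
      linarith))
  exact (lt_of_lt_of_le (EReal.bot_lt_coe _) this).ne'

theorem Model.value_ne_top (m : Model ρ W u F γ δ B d σ A) {x : ℝ} (hx : 0 < x) :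
    valueFunction ρ W u F x ≠ ⊤ :=
  ((m.value_le_bound hx).trans_lt (EReal.coe_lt_top _)).ne

/-- The value function as a real function; on `(0, ∞)` no information is lost. -/
noncomputable def realValue (ρ : ℝ) (W : Set (ℝ → ℝ)) (u : ℝ → ℝ → EReal) (F : ℝ → ℝ → ℝ)
    (x : ℝ) : ℝ :=
  (valueFunction ρ W u F x).toReal

theorem Model.coe_realValue (m : Model ρ W u F γ δ B d σ A) {x : ℝ} (hx : 0 < x) :
    (realValue ρ W u F x : EReal) = valueFunction ρ W u F x :=
  EReal.coe_toReal (m.value_ne_top hx) (m.value_ne_bot hx)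

theorem Model.realValue_le_bound (m : Model ρ W u F γ δ B d σ A) {x : ℝ} (hx : 0 < x) :
    realValue ρ W u F x ≤ payoffBound ρ γ δ B σ A x := by
  rw [← EReal.coe_le_coe_iff, m.coe_realValue hx]
  exact m.value_le_bound hx

/-- Lower bounds for the value function come from paths that leave output unused. -/
theorem Model.integral_le_realValue (m : Model ρ W u F γ δ B d σ A) {k c f g : ℝ → ℝ} {x : ℝ}
    (hx : 0 < x) (h : IsSubpath W F k c f x) (hg : IntegrableOn g (Ici 0))
    (hle : ∀ᵐ t ∂(volume.restrict (Ici (0 : ℝ))), (g t : EReal) ≤ discounted ρ u k c t) :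
    ∫ t in Ici 0, g t ≤ realValue ρ W u F x := by
  rw [← EReal.coe_le_coe_iff, m.coe_realValue hx]
  exact m.coe_integral_le_value hx h hg hle

/-- Almost optimal controls, with discounted utility as an integrable real function. -/
theorem Model.exists_near_optimal (m : Model ρ W u F γ δ B d σ A) {x : ℝ} (hx : 0 < x) {ε : ℝ}
    (hε : 0 < ε) : ∃ k, ∃ c ∈ W, ∃ g : ℝ → ℝ, IsTrajectory F k c x ∧ IntegrableOn g (Ici 0) ∧
      (∀ᵐ t ∂(volume.restrict (Ici (0 : ℝ))), discounted ρ u k c t = (g t : EReal)) ∧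
      realValue ρ W u F x - ε < ∫ t in Ici 0, g t := by
  have hlt : ((realValue ρ W u F x - ε : ℝ) : EReal) < valueFunction ρ W u F x := by
    rw [← m.coe_realValue hx, EReal.coe_lt_coe_iff]
    linarith
  obtain ⟨_, ⟨⟨k, c⟩, ⟨hc, htr, -⟩, rfl⟩, hlt⟩ := lt_sSup_iff.1 hlt
  obtain ⟨g, hg, hae, hpay⟩ := exists_integrable_of_payoff
    (m.aemeasurable_discounted htr.hasRate.continuousOn htr.nonneg hc)
    ((m.gain_le hx htr hc).trans_lt ENNReal.ofReal_lt_top).ne (ne_bot_of_gt hlt)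
  refine ⟨k, c, hc, g, htr, hg, hae, ?_⟩
  have hlt : ((realValue ρ W u F x - ε : ℝ) : EReal) < payoff ρ u k c := hlt
  rw [hpay] at hlt
  exact EReal.coe_lt_coe_iff.1 hlt

/-! ### Concavity and monotonicity of the value function -/

theorem coe_le_discounted_of_exp {k c : ℝ → ℝ} {t y : ℝ}
    (h : ((Real.exp (ρ * t) * y : ℝ) : EReal) ≤ u (c t) (k t)) :
    (y : EReal) ≤ discounted ρ u k c t := by
  have := coe_le_discounted (ρ := ρ) h
  rwa [← mul_assoc, ← Real.exp_add, show -ρ * t + ρ * t = 0 by ring, Real.exp_zero, one_mul] at this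

theorem Model.concaveOn_realValue (m : Model ρ W u F γ δ B d σ A) :
    ConcaveOn ℝ (Ioi 0) (realValue ρ W u F) := by
  rw [concaveOn_iff_forall_pos]
  refine ⟨convex_Ioi 0, fun x hx y hy a b ha hb hab => ?_⟩
  have hx : 0 < x := hx
  have hy : 0 < y := hy
  simp only [smul_eq_mul]
  refine le_of_forall_pos_lt_add fun ε hε => ?_
  obtain ⟨k₁, c₁, hc₁, g₁, htr₁, hg₁, hd₁, hV₁⟩ := m.exists_near_optimal hx hε
  obtain ⟨k₂, c₂, hc₂, g₂, htr₂, hg₂, hd₂, hV₂⟩ := m.exists_near_optimal hy hε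
  have s₁ := m.isSubpath htr₁ hc₁
  have s₂ := m.isSubpath htr₂ hc₂
  have hsub : IsSubpath W F (fun t => a * k₁ t + b * k₂ t) (fun t => a * c₁ t + b * c₂ t)
      (fun t => a * F (k₁ t) (c₁ t) + b * F (k₂ t) (c₂ t)) (a * x + b * y) := by
    refine ⟨(s₁.rate.const_mul a).add (s₂.rate.const_mul b), fun t ht => ?_, fun t ht => ?_, ?_, ?_⟩
    · exact add_nonneg (mul_nonneg ha.le (s₁.k_nonneg t ht)) (mul_nonneg hb.le (s₂.k_nonneg t ht))
    · exact add_nonneg (mul_nonneg ha.le (s₁.c_nonneg t ht)) (mul_nonneg hb.le (s₂.c_nonneg t ht))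
    · filter_upwards [ae_restrict_mem measurableSet_Ici] with t ht
      exact m.tech.concave_coord (s₁.k_nonneg t ht) (s₁.c_nonneg t ht) (s₂.k_nonneg t ht)
        (s₂.c_nonneg t ht) ha.le hb.le hab
    · rcases s₁.bdd with hW | h₁
      · exact Or.inl hW
      rcases s₂.bdd with hW | h₂
      · exact Or.inl hW
      refine Or.inr fun T hT => ?_
      obtain ⟨M₁, hM₁⟩ := h₁ T hT
      obtain ⟨M₂, hM₂⟩ := h₂ T hT
      refine ⟨a * M₁ + b * M₂, ?_⟩
      filter_upwards [hM₁, hM₂] with t ht₁ ht₂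
      have := mul_le_mul_of_nonneg_left ht₁ ha.le
      have := mul_le_mul_of_nonneg_left ht₂ hb.le
      linarith
  have hle := m.integral_le_realValue (by positivity) hsub
    (g := fun t => a * g₁ t + b * g₂ t) ((hg₁.const_mul a).add (hg₂.const_mul b)) (by
      filter_upwards [hd₁, hd₂, ae_restrict_mem measurableSet_Ici] with t ht₁ ht₂ ht
      refine coe_le_discounted_of_exp ?_
      have := m.util.concave (c₁ t, k₁ t) ⟨s₁.c_nonneg t ht, s₁.k_nonneg t ht⟩
        (c₂ t, k₂ t) ⟨s₂.c_nonneg t ht, s₂.k_nonneg t ht⟩ a b ha hb hab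
      simp only [eq_coe_of_discounted ht₁, eq_coe_of_discounted ht₂, ← EReal.coe_mul,
        ← EReal.coe_add] at this
      rw [show Real.exp (ρ * t) * (a * g₁ t + b * g₂ t) =
        a * (Real.exp (ρ * t) * g₁ t) + b * (Real.exp (ρ * t) * g₂ t) by ring]
      exact this)
  rw [integral_add (hg₁.const_mul a) (hg₂.const_mul b), integral_const_mul,
    integral_const_mul] at hle
  nlinarith [mul_lt_mul_of_pos_left hV₁ ha, mul_lt_mul_of_pos_left hV₂ hb]

theorem Model.monotoneOn_realValue (m : Model ρ W u F γ δ B d σ A) :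
    MonotoneOn (realValue ρ W u F) (Ioi 0) := by
  intro x hx y hy hxy
  have hx : 0 < x := hx
  refine le_of_forall_pos_lt_add fun ε hε => ?_
  obtain ⟨k, c, hc, g, htr, hg, hd, hV⟩ := m.exists_near_optimal hx hε
  have s := m.isSubpath htr hc
  have hz : ∀ t, 0 ≤ (y - x) * Real.exp (-d * t) := fun t =>
    mul_nonneg (by linarith) (Real.exp_pos _).le
  -- An additional stock that decays at rate `d` can be carried along without loss of output.
  have hsub : IsSubpath W F (fun t => k t + (y - x) * Real.exp (-d * t)) c
      (fun t => F (k t) (c t) + -d * ((y - x) * Real.exp (-d * t))) y := by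
    refine ⟨?_, fun t ht => add_nonneg (s.k_nonneg t ht) (hz t), s.c_nonneg, ?_, ?_⟩
    · have := s.rate.add (HasRate.exp_decay (y - x) d)
      rwa [add_sub_cancel] at this
    · filter_upwards [ae_restrict_mem measurableSet_Ici] with t ht
      have := m.F_slope _ _ _ (s.k_nonneg t ht) (hz t) (s.c_nonneg t ht)
      linarith
    · refine s.bdd.imp_right fun h T hT => ?_
      obtain ⟨M, hM⟩ := h T hT
      refine ⟨M + d * (y - x), ?_⟩
      filter_upwards [hM, ae_restrict_mem measurableSet_Icc] with t ht1 ht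
      have hd := m.d_pos
      have : Real.exp (-d * t) ≤ 1 := Real.exp_le_one_iff.2 (by nlinarith [ht.1])
      nlinarith [mul_le_mul_of_nonneg_left this (mul_nonneg hd.le (sub_nonneg.2 hxy))]
  have := m.integral_le_realValue hy hsub hg (by
    filter_upwards [hd, ae_restrict_mem measurableSet_Ici] with t h1 h2
    rw [← h1]
    refine discounted_mono (m.util.nondecreasing _ _ _ _ (s.c_nonneg t h2) le_rfl
      (s.k_nonneg t h2) ?_)
    linarith [hz t])
  linarith

theorem Model.continuousOn_realValue (m : Model ρ W u F γ δ B d σ A) :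
    ContinuousOn (realValue ρ W u F) (Ioi 0) :=
  m.concaveOn_realValue.continuousOn isOpen_Ioi

/-! ### The subsolution property -/

theorem integrableOn_comp_sub {g : ℝ → ℝ} (hg : IntegrableOn g (Ici 0)) (a : ℝ) :
    IntegrableOn (fun t => g (t - a)) (Ici a) ∧
      ∫ t in Ici a, g (t - a) = ∫ t in Ici 0, g t := by
  have hmp := measurePreserving_sub_right (volume : Measure ℝ) a
  have hemb : MeasurableEmbedding fun t : ℝ => t - a :=
    (MeasurableEquiv.subRight a).measurableEmbedding
  have hpre : (fun t : ℝ => t - a) ⁻¹' Ici 0 = Ici a := by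
    ext t
    simp
  rw [← hpre]
  exact ⟨(hmp.integrableOn_comp_preimage hemb).2 hg, hmp.setIntegral_preimage_emb hemb g (Ici 0)⟩

theorem ae_Ici_comp_sub {P : ℝ → Prop} (h : ∀ᵐ t ∂(volume.restrict (Ici (0 : ℝ))), P t) (a : ℝ) :
    ∀ᵐ t ∂(volume.restrict (Ici a)), P (t - a) := by
  have hmp := (measurePreserving_sub_right (volume : Measure ℝ) a).restrict_preimage
    (measurableSet_Ici (a := (0 : ℝ)))
  have hpre : (fun t : ℝ => t - a) ⁻¹' Ici 0 = Ici a := by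
    ext t
    simp
  rw [hpre] at hmp
  exact hmp.quasiMeasurePreserving.ae h

/-- The dynamic programming inequality along a straight line of slope `v`: the stock moves from `x`
to `x + v T` while at least the utility `M` is enjoyed, and an almost optimal control is used from
then on. -/
theorem Model.value_ge_line (m : Model ρ W u F γ δ B d σ A) {x v c M T : ℝ} (hT : 0 < T)
    (hc : 0 ≤ c) (hline : ∀ t, 0 ≤ t → t ≤ T →
      0 < x + v * t ∧ v ≤ F (x + v * t) c ∧ (M : EReal) ≤ u c (x + v * t)) :
    M * ((1 - Real.exp (-ρ * T)) / ρ) + Real.exp (-ρ * T) * realValue ρ W u F (x + v * T) ≤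
      realValue ρ W u F x := by
  have hρ := m.control.rho_pos
  have hx : 0 < x := by simpa using (hline 0 le_rfl hT.le).1
  have hy : 0 < x + v * T := (hline T hT.le le_rfl).1
  refine le_of_forall_pos_lt_add fun ε hε => ?_
  obtain ⟨k₂, c₂, hc₂, g₂, htr, hg₂, hd₂, hV⟩ := m.exists_near_optimal hy hε
  have s := m.isSubpath htr hc₂
  have hr₁ : HasRate (fun t => x + v * t) (fun _ => v) x := by
    have := HasRate.of_hasDerivAt (k := fun t => x + v * t) (f := fun _ => v) (fun t => ?_)
      continuous_const
    · simpa using this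
    · simpa using ((hasDerivAt_id t).const_mul v).const_add x
  have hsub : IsSubpath W F (fun t => if t ≤ T then x + v * t else k₂ (t - T))
      (fun t => if t ≤ T then c else c₂ (t - T))
      (fun t => if t ≤ T then v else F (k₂ (t - T)) (c₂ (t - T))) x := by
    refine ⟨hr₁.concat hT.le s.rate, fun t ht => ?_, fun t ht => ?_, ?_, ?_⟩
    · split_ifs with h
      · exact (hline t ht h).1.le
      · exact s.k_nonneg _ (by linarith)
    · split_ifs with h
      · exact hc
      · exact s.c_nonneg _ (by linarith)
    · filter_upwards [ae_restrict_mem measurableSet_Ici] with t ht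
      split_ifs with h
      · exact (hline t ht h).2.1
      · exact le_rfl
    · refine s.bdd.imp_right fun hb S hS => ?_
      obtain ⟨N, hN⟩ := hb S hS
      refine ⟨max (-v) N, ?_⟩
      rw [ae_restrict_iff' measurableSet_Icc] at hN ⊢
      have hN' : ∀ᵐ t : ℝ, t - T ∈ Icc 0 S → -N ≤ F (k₂ (t - T)) (c₂ (t - T)) :=
        (measurePreserving_sub_right (volume : Measure ℝ) T).quasiMeasurePreserving.ae hN
      filter_upwards [hN'] with t ht1 ht2
      split_ifs with h
      · linarith [le_max_left (-v) N]
      · linarith [le_max_right (-v) N, ht1 ⟨by linarith, by linarith [ht2.2]⟩]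
  obtain ⟨i2, e2⟩ := integrableOn_comp_sub hg₂ T
  set g : ℝ → ℝ := fun t => if t ≤ T then Real.exp (-ρ * t) * M
    else Real.exp (-ρ * T) * g₂ (t - T) with hg
  have hIoi : EqOn (fun t => Real.exp (-ρ * T) * g₂ (t - T)) g (Ioi T) := fun t ht => by
    have ht : T < t := ht
    simp only [hg, if_neg (not_le.2 ht)]
  have hIcc : EqOn (fun t => Real.exp (-ρ * t) * M) g (Icc 0 T) := fun t ht => by
    simp only [hg, if_pos ht.2]
  have ic : Continuous fun t => Real.exp (-ρ * t) * M := by fun_prop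
  have i1 : IntegrableOn g (Icc 0 T) :=
    (ic.integrableOn_Icc).congr_fun hIcc measurableSet_Icc
  have i2' : IntegrableOn (fun t => Real.exp (-ρ * T) * g₂ (t - T)) (Ioi T) :=
    (i2.mono_set Ioi_subset_Ici_self).const_mul _
  have i3 : IntegrableOn g (Ioi T) := i2'.congr_fun hIoi measurableSet_Ioi
  have hun : Ici (0 : ℝ) = Icc 0 T ∪ Ioi T := (Icc_union_Ioi_eq_Ici hT.le).symm
  have hdisj : Disjoint (Icc 0 T) (Ioi T) :=
    Set.disjoint_left.2 fun t ht ht' => not_lt.2 ht.2 ht'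
  have hint : ∫ t in Ici 0, g t = M * ((1 - Real.exp (-ρ * T)) / ρ) +
      Real.exp (-ρ * T) * ∫ t in Ici 0, g₂ t := by
    rw [hun, setIntegral_union hdisj measurableSet_Ioi i1 i3,
      ← setIntegral_congr_fun measurableSet_Icc hIcc,
      ← setIntegral_congr_fun measurableSet_Ioi hIoi,
      integral_const_mul, ← integral_Ici_eq_integral_Ioi, e2, integral_Icc_eq_integral_Ioc,
      ← intervalIntegral.integral_of_le hT.le, intervalIntegral.integral_mul_const,
      integral_exp_neg hρ.ne', ← hun]
    ring
  have hle := m.integral_le_realValue hx hsub (g := g) (by rw [hun]; exact i1.union i3) (by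
    have h1 := ae_Ici_comp_sub hd₂ T
    rw [ae_restrict_iff' measurableSet_Ici] at h1 ⊢
    filter_upwards [h1] with t h1 ht
    by_cases h : t ≤ T
    · simp only [hg, if_pos h]
      refine coe_le_discounted ?_
      simp only [if_pos h]
      exact (hline t ht h).2.2
    · simp only [hg, if_neg h]
      refine coe_le_discounted_of_exp ?_
      simp only [if_neg h]
      have h2 := eq_coe_of_discounted (h1 (not_le.1 h).le)
      rw [h2, EReal.coe_le_coe_iff, ← mul_assoc, ← Real.exp_add]
      refine le_of_eq ?_
      congr 2
      ring)
  rw [hint] at hle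
  have hexp : Real.exp (-ρ * T) ≤ 1 := Real.exp_le_one_iff.2 (by nlinarith)
  nlinarith [mul_lt_mul_of_pos_left hV (Real.exp_pos (-ρ * T)), Real.exp_pos (-ρ * T)]

theorem hasDerivAt_nonpos_of_le {ψ : ℝ → ℝ} {p r : ℝ} (h : HasDerivAt ψ p 0) (hr : 0 < r)
    (hle : ∀ t, 0 < t → t < r → ψ t ≤ ψ 0) : p ≤ 0 := by
  have h1 := (hasDerivWithinAt_iff_tendsto_slope' (self_notMem_Ioi (a := (0 : ℝ)))).1
    (h.hasDerivWithinAt (s := Ioi 0))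
  refine le_of_tendsto h1 ?_
  filter_upwards [Ioo_mem_nhdsGT hr] with t ht
  rw [slope_def_field]
  exact div_nonpos_of_nonpos_of_nonneg (by linarith [hle t ht.1 ht.2]) (by linarith [ht.1])

theorem Model.eventually_line (m : Model ρ W u F γ δ B d σ A) {x v c : ℝ} (hx : 0 < x)
    (hc : 0 ≤ c) {v' M : ℝ} (hv : v' < F x c) (hM : (M : EReal) < u c x) :
    ∀ᶠ t in 𝓝 (0 : ℝ), 0 < x + v * t ∧ v' ≤ F (x + v * t) c ∧ (M : EReal) ≤ u c (x + v * t) := by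
  have c0 : Continuous fun t : ℝ => x + v * t := by fun_prop
  have h0 : ∀ᶠ t in 𝓝 (0 : ℝ), 0 < x + v * t :=
    c0.continuousAt.eventually (lt_mem_nhds (by simpa using hx))
  have c1 : Continuous fun t : ℝ => F (max (x + v * t) 0) (max c 0) :=
    m.F_cont.comp (c0.prodMk continuous_const)
  have c2 : Continuous fun t : ℝ => u (max c 0) (max (x + v * t) 0) :=
    m.u_cont.comp ((continuous_const (y := c)).prodMk c0)
  have h1 := (c1.continuousAt (x := 0)).eventually (lt_mem_nhds (a := v')
    (by simpa [max_eq_left hx.le, max_eq_left hc] using hv))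
  have h2 := (c2.continuousAt (x := 0)).eventually (lt_mem_nhds (a := (M : EReal))
    (by simpa [max_eq_left hx.le, max_eq_left hc] using hM))
  filter_upwards [h0, h1, h2] with t h0 h1 h2
  rw [max_eq_left h0.le, max_eq_left hc] at h1 h2
  exact ⟨h0, h1.le, h2.le⟩

/-- The subsolution inequality for one level of consumption. -/
theorem Model.hamiltonian_term_le (m : Model ρ W u F γ δ B d σ A) {x : ℝ} (hx : 0 < x) {φ : ℝ → ℝ}
    {q : ℝ} (hφ : HasDerivAt φ q x) (hφx : φ x = realValue ρ W u F x)
    (hle : ∀ᶠ y in 𝓝 x, φ y ≤ realValue ρ W u F y) {c : ℝ} (hc : 0 ≤ c) :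
    ((F x c * q : ℝ) : EReal) + u c x ≤ ((ρ * realValue ρ W u F x : ℝ) : EReal) := by
  have hρ := m.control.rho_pos
  rcases eq_or_ne (u c x) ⊥ with hbot | hbot
  · rw [hbot, EReal.add_bot]
    exact bot_le
  obtain ⟨U, hU⟩ : ∃ U : ℝ, u c x = U :=
    ⟨_, (EReal.coe_toReal (m.util.ne_top c x hc hx.le) hbot).symm⟩
  have key : ∀ M < U, ∀ v < F x c, M + q * v ≤ ρ * realValue ρ W u F x := by
    intro M hM v hv
    -- The dynamic programming inequality reads `ψ T ≤ ψ 0` for small `T > 0`.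
    have h1 := m.eventually_line (v := v) hx hc hv (hU ▸ EReal.coe_lt_coe_iff.2 hM)
    have h2 : ∀ᶠ t in 𝓝 (0 : ℝ), φ (x + v * t) ≤ realValue ρ W u F (x + v * t) := by
      have : Tendsto (fun t : ℝ => x + v * t) (𝓝 0) (𝓝 x) := by
        have : Continuous fun t : ℝ => x + v * t := by fun_prop
        simpa using this.tendsto 0
      exact this.eventually hle
    obtain ⟨r, hr, hball⟩ := Metric.eventually_nhds_iff.1 (h1.and h2)
    have hin : ∀ t, 0 ≤ t → t < r → dist t 0 < r := fun t ht htr => by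
      rwa [Real.dist_eq, sub_zero, abs_of_nonneg ht]
    set ψ : ℝ → ℝ := fun T => M * ((1 - Real.exp (-ρ * T)) / ρ) +
      Real.exp (-ρ * T) * φ (x + v * T) with hψ
    have hderiv : HasDerivAt ψ (M + (-ρ * φ x + q * v)) 0 := by
      have e1 : HasDerivAt (fun T : ℝ => Real.exp (-ρ * T)) (-ρ) 0 := by
        simpa using ((hasDerivAt_id (0 : ℝ)).const_mul (-ρ)).exp
      have e2 : HasDerivAt (fun T : ℝ => x + v * T) v 0 := by
        simpa using ((hasDerivAt_id (0 : ℝ)).const_mul v).const_add x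
      have e3 : HasDerivAt (fun T : ℝ => φ (x + v * T)) (q * v) 0 :=
        HasDerivAt.comp (0 : ℝ) (by simpa using hφ) e2
      convert! (((e1.const_sub 1).div_const ρ).const_mul M).add (e1.mul e3) using 1
      simp only [mul_zero, Real.exp_zero, add_zero]
      field_simp
    have h3 := hasDerivAt_nonpos_of_le hderiv hr fun T hT hTr => by
      have := m.value_ge_line (v := v) (M := M) hT hc fun t ht htT =>
        (hball (hin t ht (htT.trans_lt hTr))).1
      have h4 := (hball (hin T hT.le hTr)).2
      simp only [hψ, mul_zero, Real.exp_zero, sub_self, zero_div, zero_add, one_mul, add_zero]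
      rw [hφx]
      have := mul_le_mul_of_nonneg_left h4 (Real.exp_pos (-ρ * T)).le
      linarith
    rw [hφx] at h3
    linarith
  rw [hU, ← EReal.coe_add, EReal.coe_le_coe_iff]
  have hlimM : ∀ v < F x c, U + q * v ≤ ρ * realValue ρ W u F x := fun v hv => by
    have : ∀ M < U, M ≤ ρ * realValue ρ W u F x - q * v := fun M hM => by
      linarith [key M hM v hv]
    linarith [le_of_forall_lt_imp_le_of_dense this]
  have hlim : Tendsto (fun v => U + q * v) (𝓝[<] (F x c)) (𝓝 (U + q * F x c)) := by
    have : Continuous fun v => U + q * v := by fun_prop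
    exact (this.tendsto _).mono_left nhdsWithin_le_nhds
  have := le_of_tendsto hlim (eventually_nhdsWithin_of_forall hlimM)
  linarith

theorem Model.isViscositySubsolution (m : Model ρ W u F γ δ B d σ A) :
    IsViscositySubsolution ρ u F (realValue ρ W u F) := by
  refine ⟨m.continuousOn_realValue.upperSemicontinuousOn, fun x hx U φ hU hxU hU0 hφ hφx hle => ?_⟩
  have hd : HasDerivAt φ (deriv φ x) x :=
    ((hφ.differentiableOn one_ne_zero).differentiableAt (hU.mem_nhds hxU)).hasDerivAt
  rw [EReal.sub_nonpos]
  exact iSup₂_le fun c hc => m.hamiltonian_term_le hx hd hφx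
    (Filter.mem_of_superset (hU.mem_nhds hxU) hle) hc

/-! ### Strict monotonicity -/

/-- A concave function lies below the tangent at `x` of any function that touches it at `x` from
above. -/
theorem concaveOn_le_tangent {s : Set ℝ} {f φ : ℝ → ℝ} (hf : ConcaveOn ℝ s f) {x y q : ℝ}
    (hx : x ∈ s) (hy : y ∈ s) (hφ : HasDerivAt φ q x) (hφx : φ x = f x)
    (hle : ∀ᶠ z in 𝓝 x, f z ≤ φ z) : f y ≤ f x + q * (y - x) := by
  have e2 : HasDerivAt (fun t : ℝ => x + t * (y - x)) (y - x) 0 := by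
    simpa using ((hasDerivAt_id (0 : ℝ)).mul_const (y - x)).const_add x
  have e3 : HasDerivAt (fun t : ℝ => φ (x + t * (y - x))) (q * (y - x)) 0 :=
    HasDerivAt.comp (0 : ℝ) (by simpa using hφ) e2
  have h1 := (hasDerivWithinAt_iff_tendsto_slope' (self_notMem_Ioi (a := (0 : ℝ)))).1
    (e3.hasDerivWithinAt (s := Ioi 0))
  have h2 : ∀ᶠ t in 𝓝 (0 : ℝ), f (x + t * (y - x)) ≤ φ (x + t * (y - x)) := by
    have : Tendsto (fun t : ℝ => x + t * (y - x)) (𝓝 0) (𝓝 x) := by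
      simpa using e2.continuousAt.tendsto
    exact this.eventually hle
  have h3 : f y - f x ≤ q * (y - x) := by
    refine ge_of_tendsto h1 ?_
    filter_upwards [Ioo_mem_nhdsGT (zero_lt_one' ℝ), nhdsWithin_le_nhds h2] with t ht ht2
    rw [slope_def_field]
    simp only [zero_mul, add_zero, sub_zero]
    rw [le_div_iff₀ ht.1]
    have := hf.2 hx hy (sub_nonneg.2 ht.2.le) ht.1.le (sub_add_cancel 1 t)
    simp only [smul_eq_mul] at this
    rw [show (1 - t) * x + t * y = x + t * (y - x) by ring] at this
    rw [hφx]
    linarith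
  linarith

/-- A tangent of utility as a function of consumption. -/
theorem UtilityAssumption.exists_tangent (h : UtilityAssumption u) {N K : ℝ} (hN : 0 < N)
    (hK : 0 < K) : ∃ p, 0 ≤ p ∧
      ∀ c, 0 ≤ c → u c K ≤ (((u N K).toReal + p * (c - N) : ℝ) : EReal) := by
  have hfin : ∀ c, 0 < c → ((u c K).toReal : EReal) = u c K := fun c hc =>
    EReal.coe_toReal (h.ne_top _ _ hc.le hK.le) (h.ne_bot hc hK)
  have hconc : ConcaveOn ℝ (Ioi 0) fun c => (u c K).toReal := by
    rw [concaveOn_iff_forall_pos]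
    refine ⟨convex_Ioi 0, fun x hx y hy a b ha hb hab => ?_⟩
    have hx : 0 < x := hx
    have hy : 0 < y := hy
    have := h.concave (x, K) ⟨hx.le, hK.le⟩ (y, K) ⟨hy.le, hK.le⟩ a b ha hb hab
    simp only [← add_mul, hab, one_mul] at this
    rw [← hfin x hx, ← hfin y hy, ← hfin (a * x + b * y) (by positivity), ← EReal.coe_mul,
      ← EReal.coe_mul, ← EReal.coe_add, EReal.coe_le_coe_iff] at this
    exact this
  have hdiff : DifferentiableAt ℝ (fun c => (u c K).toReal) N := by
    have h1 : DifferentiableAt ℝ (fun x : ℝ × ℝ => (u x.1 x.2).toReal) (N, K) :=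
      (h.contDiffOn.differentiableOn one_ne_zero).differentiableAt
        ((isOpen_Ioi.prod isOpen_Ioi).mem_nhds ⟨hN, hK⟩)
    exact h1.comp (f := fun c : ℝ => (c, K)) N (by fun_prop)
  have htan : ∀ c, 0 < c → (u c K).toReal ≤ (u N K).toReal +
      deriv (fun c => (u c K).toReal) N * (c - N) := fun c hc =>
    concaveOn_le_tangent hconc hN hc hdiff.hasDerivAt rfl (Eventually.of_forall fun _ => le_rfl)
  refine ⟨deriv (fun c => (u c K).toReal) N, ?_, fun c hc => ?_⟩
  · have h1 := htan (N + 1) (by linarith)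
    have h2 := h.nondecreasing N (N + 1) K K hN.le (by linarith) hK.le le_rfl
    rw [← hfin N hN, ← hfin (N + 1) (by linarith), EReal.coe_le_coe_iff] at h2
    linarith
  · have hlim : Tendsto
        (fun s => (((u N K).toReal + deriv (fun c => (u c K).toReal) N * (s - N) : ℝ)
        : EReal)) (𝓝[>] c) (𝓝 (((u N K).toReal + deriv (fun c => (u c K).toReal) N * (c - N) : ℝ)
        : EReal)) := by
      refine (Continuous.tendsto ?_ c).mono_left nhdsWithin_le_nhds
      exact continuous_coe_real_ereal.comp (by fun_prop)
    refine ge_of_tendsto hlim (eventually_nhdsWithin_of_forall fun s hs => ?_)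
    have hs : c < s := hs
    refine (h.nondecreasing c s K K hc hs.le hK.le le_rfl).trans ?_
    rw [← hfin s (hc.trans_lt hs), EReal.coe_le_coe_iff]
    exact htan s (hc.trans_lt hs)

theorem Model.strictMonoOn_realValue (m : Model ρ W u F γ δ B d σ A) :
    StrictMonoOn (realValue ρ W u F) (Ioi 0) := by
  intro x hx y hy hxy
  have hx : 0 < x := hx
  have hy : 0 < y := hy
  have hρ := m.control.rho_pos
  have hγ := m.γ_pos
  have hδ := m.δ_pos
  by_contra hnot
  set v := realValue ρ W u F x with hv
  have hyx : realValue ρ W u F y = v :=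
    le_antisymm (not_lt.1 hnot) (m.monotoneOn_realValue hx hy hxy.le)
  -- By concavity the value is constant from `x` on.
  have hconst : ∀ z, x < z → realValue ρ W u F z = v := by
    intro z hz
    have hz0 : 0 < z := hx.trans hz
    refine le_antisymm ?_ (m.monotoneOn_realValue hx hz0 hz.le)
    rcases le_or_gt z y with h | h
    · exact (m.monotoneOn_realValue hz0 hy h).trans hyx.le
    · have h1 : 0 < z - x := by linarith
      have := m.concaveOn_realValue.2 hx hz0 (div_nonneg (by linarith : 0 ≤ z - y) h1.le)
        (div_nonneg (by linarith : 0 ≤ y - x) h1.le) (by field_simp; ring)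
      simp only [smul_eq_mul] at this
      rw [show (z - y) / (z - x) * x + (y - x) / (z - x) * z = y by field_simp; ring, hyx,
        ← hv] at this
      have h2 := mul_le_mul_of_nonneg_left this h1.le
      rw [show (z - x) * ((z - y) / (z - x) * v + (y - x) / (z - x) * realValue ρ W u F z) =
        (z - y) * v + (y - x) * realValue ρ W u F z by field_simp] at h2
      nlinarith
  -- Hence constants are test functions, and utility never exceeds `ρ v`.
  have hbound : ∀ c k, 0 ≤ c → 0 ≤ k → u c k ≤ ((ρ * v : ℝ) : EReal) := by
    intro c k hc hk
    set z := max k (x + 1) with hz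
    have hxz : x < z := lt_of_lt_of_le (by linarith) (le_max_right _ _)
    have := m.hamiltonian_term_le (x := z) (hx.trans hxz) (φ := fun _ => v) (hasDerivAt_const z v)
      (hconst z hxz).symm (by
        filter_upwards [Ioi_mem_nhds hxz] with w hw
        exact (hconst w hw).ge) hc
    rw [hconst z hxz, mul_zero, EReal.coe_zero, zero_add] at this
    exact (m.util.nondecreasing c c k z hc le_rfl hk (le_max_left _ _)).trans this
  -- On `[0, 1]` the budget keeps the average of consumption below `N` and the stock below `K`.
  set m₁ := (1 - Real.exp (-ρ * 1)) / ρ with hm₁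
  have hm₁0 : 0 < m₁ := div_pos (sub_pos.2 (Real.exp_lt_one_iff.2 (by linarith))) hρ
  have hB := m.B_nonneg
  set K₀ := x + B / γ with hK₀
  have hK₀0 : 0 < K₀ := by positivity
  set K := K₀ * Real.exp (γ * 1) with hK
  have hK0 : 0 < K := by positivity
  set N := Real.exp γ * (K₀ / δ) / m₁ with hN
  have hN0 : 0 < N := by positivity
  obtain ⟨p, hp, htan⟩ := m.util.exists_tangent hN0 hK0
  have hfin : ∀ c, 0 < c → ((u c K).toReal : EReal) = u c K := fun c hc =>
    EReal.coe_toReal (m.util.ne_top _ _ hc.le hK0.le) (m.util.ne_bot hc hK0)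
  set U := (u N K).toReal with hU
  have hUv : U < ρ * v := by
    rw [← EReal.coe_lt_coe_iff, hfin N hN0]
    exact (m.util.increasing N (N + 1) K hN0 (by linarith) hK0).trans_le
      (hbound _ _ (by linarith) hK0.le)
  have hε : 0 < m₁ * (ρ * v - U) := mul_pos hm₁0 (by linarith)
  obtain ⟨k, c, hc, g, htr, hg, hd, hV⟩ := m.exists_near_optimal hx hε
  rw [← hv] at hV
  have hcI := locallyIntegrableOn_Ici_iff.1 (m.control.locallyIntegrableOn hc) 1 zero_le_one
  have hgle : ∀ᵐ t ∂(volume.restrict (Ici (0 : ℝ))), g t ≤ Real.exp (-ρ * t) * (ρ * v) := by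
    filter_upwards [hd, ae_restrict_mem measurableSet_Ici] with t h1 h2
    rw [← EReal.coe_le_coe_iff, ← h1]
    exact discounted_le_coe (hbound _ _ (m.control.nonneg hc h2) (htr.nonneg t h2))
  have hgle1 : ∀ᵐ t ∂(volume.restrict (Icc (0 : ℝ) 1)),
      g t ≤ Real.exp (-ρ * t) * (U - p * N) + p * (Real.exp (-ρ * t) * c t) := by
    filter_upwards [ae_restrict_of_ae_restrict_of_subset Icc_subset_Ici_self hd,
      ae_restrict_mem measurableSet_Icc] with t h1 h2
    have hct := m.control.nonneg hc h2.1
    rw [← EReal.coe_le_coe_iff, ← h1, show Real.exp (-ρ * t) * (U - p * N) +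
      p * (Real.exp (-ρ * t) * c t) = Real.exp (-ρ * t) * (U + p * (c t - N)) by ring]
    refine discounted_le_coe (le_trans ?_ (htan (c t) hct))
    refine m.util.nondecreasing _ _ _ _ hct le_rfl (htr.nonneg t h2.1) ?_
    refine (m.capital_le htr hc h2.1).trans ?_
    rw [hK]
    gcongr
    exact h2.2
  have hun : Ici (0 : ℝ) = Icc 0 1 ∪ Ioi 1 := (Icc_union_Ioi_eq_Ici zero_le_one).symm
  have hdisj : Disjoint (Icc (0 : ℝ) 1) (Ioi 1) :=
    Set.disjoint_left.2 fun t ht ht' => not_lt.2 ht.2 ht'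
  have j1 : IntervalIntegrable (fun t => Real.exp (-ρ * t) * (U - p * N)) volume 0 1 :=
    (by fun_prop : Continuous fun t => Real.exp (-ρ * t) * (U - p * N)).intervalIntegrable _ _
  have j2 : IntervalIntegrable (fun t => Real.exp (-ρ * t) * c t) volume 0 1 :=
    hcI.continuousOn_mul (by fun_prop)
  have hcons : ∫ t in (0 : ℝ)..1, Real.exp (-ρ * t) * c t ≤ m₁ * N := by
    have j3 : IntervalIntegrable (fun t => Real.exp (-γ * t) * c t) volume 0 1 :=
      hcI.continuousOn_mul (by fun_prop)
    calc ∫ t in (0 : ℝ)..1, Real.exp (-ρ * t) * c t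
        ≤ ∫ t in (0 : ℝ)..1, Real.exp γ * (Real.exp (-γ * t) * c t) := by
          refine intervalIntegral.integral_mono_on zero_le_one j2 (j3.const_mul _) fun t ht => ?_
          rw [← mul_assoc, ← Real.exp_add]
          refine mul_le_mul_of_nonneg_right (Real.exp_le_exp.2 ?_) (m.control.nonneg hc ht.1)
          nlinarith [ht.1, ht.2]
      _ ≤ Real.exp γ * (K₀ / δ) := by
          rw [intervalIntegral.integral_const_mul]
          exact mul_le_mul_of_nonneg_left (m.integral_consumption_le htr hc zero_le_one)
            (Real.exp_pos _).le
      _ = m₁ * N := by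
          rw [hN]
          field_simp
  have p1 : ∫ t in Icc (0 : ℝ) 1, g t ≤ m₁ * U := by
    calc ∫ t in Icc (0 : ℝ) 1, g t
        ≤ ∫ t in Icc (0 : ℝ) 1, (Real.exp (-ρ * t) * (U - p * N) +
            p * (Real.exp (-ρ * t) * c t)) := by
          refine setIntegral_mono_ae_restrict (hg.mono_set Icc_subset_Ici_self) ?_ hgle1
          exact (intervalIntegrable_iff_integrableOn_Icc_of_le zero_le_one).1
            (j1.add (j2.const_mul p))
      _ = (U - p * N) * m₁ + p * ∫ t in (0 : ℝ)..1, Real.exp (-ρ * t) * c t := by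
          rw [integral_Icc_eq_integral_Ioc, ← intervalIntegral.integral_of_le zero_le_one,
            intervalIntegral.integral_add j1 (j2.const_mul p), intervalIntegral.integral_mul_const,
            integral_exp_neg hρ.ne', intervalIntegral.integral_const_mul]
          ring
      _ ≤ m₁ * U := by nlinarith [mul_le_mul_of_nonneg_left hcons hp]
  have p2 : ∫ t in Ioi (1 : ℝ), g t ≤ (1 / ρ - m₁) * (ρ * v) := by
    calc ∫ t in Ioi (1 : ℝ), g t ≤ ∫ t in Ioi (1 : ℝ), Real.exp (-ρ * t) * (ρ * v) := by
          refine setIntegral_mono_ae_restrict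
            (hg.mono_set (Ioi_subset_Ici zero_le_one)) ?_
            (ae_restrict_of_ae_restrict_of_subset (Ioi_subset_Ici zero_le_one) hgle)
          exact ((integrableOn_exp_neg hρ).mono_set (Ioi_subset_Ioi zero_le_one)).mul_const _
      _ = (1 / ρ - m₁) * (ρ * v) := by
          rw [integral_mul_const, integral_exp_mul_Ioi (neg_neg_of_pos hρ), hm₁]
          congr 1
          field_simp
          ring
  have hsum : ∫ t in Ici 0, g t = (∫ t in Icc (0 : ℝ) 1, g t) + ∫ t in Ioi (1 : ℝ), g t := by
    rw [hun, setIntegral_union hdisj measurableSet_Ioi (hg.mono_set Icc_subset_Ici_self)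
      (hg.mono_set (Ioi_subset_Ici zero_le_one))]
  have h4 : 1 / ρ * (ρ * v) = v := by field_simp
  rw [hsum] at hV
  nlinarith

/-! ### The supersolution property -/

theorem rpow_le_linear {σ : ℝ} (hσ0 : 0 < σ) (hσ1 : σ < 1) {τ : ℝ} (hτ : 0 < τ) :
    ∃ D, ∀ c, 0 ≤ c → c ^ σ ≤ D + τ * c := by
  refine ⟨(τ ^ (σ - 1)⁻¹) ^ σ, fun c hc => ?_⟩
  have := rpow_le_add hσ0 hσ1 hc (Real.rpow_pos_of_pos hτ (σ - 1)⁻¹)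
  rwa [Real.rpow_inv_rpow hτ.le (by linarith)] at this

/-- The Hamiltonian is upper semicontinuous: a strict bound on it persists near `(x, q)`. Large
consumption is excluded by `F ≤ γ k + B - δ c` and the sublinear growth of utility, the rest is
compactness. -/
theorem Model.eventually_hamiltonian_le (m : Model ρ W u F γ δ B d σ A) {x q h : ℝ} (hx : 0 < x)
    (hq : 0 < q) (hlt : ∀ c, 0 ≤ c → ((F x c * q : ℝ) : EReal) + u c x < (h : EReal)) :
    ∀ᶠ p : ℝ × ℝ in 𝓝 (x, q), ∀ c, 0 ≤ c →
      ((F p.1 c * p.2 : ℝ) : EReal) + u c p.1 ≤ (h : EReal) := by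
  have hA := m.A_nonneg
  have hδ := m.δ_pos
  have hγ := m.γ_pos
  have hB := m.B_nonneg
  set τ := q * δ / (4 * (A + 1)) with hτ
  have hτ0 : 0 < τ := by positivity
  obtain ⟨D, hD⟩ := rpow_le_linear m.σ_pos m.σ_lt hτ0
  have hAτ : A * τ ≤ q * δ / 4 := by
    rw [hτ, mul_div_assoc', div_le_div_iff₀ (by positivity) (by positivity)]
    nlinarith [mul_pos hq hδ]
  set R := 2 * q * (γ * (2 * x) + B) + A * (1 + D + (2 * x) ^ σ) with hR
  set N := max 0 ((R - h) / (q * δ / 4)) with hN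
  have hpos : ∀ᶠ p : ℝ × ℝ in 𝓝 (x, q), (0 < p.1 ∧ p.1 < 2 * x) ∧ (q / 2 < p.2 ∧ p.2 < 2 * q) := by
    have h1 : ∀ᶠ k in 𝓝 x, 0 < k ∧ k < 2 * x :=
      (lt_mem_nhds hx).and (gt_mem_nhds (by linarith))
    have h2 : ∀ᶠ y in 𝓝 q, q / 2 < y ∧ y < 2 * q :=
      (lt_mem_nhds (by linarith)).and (gt_mem_nhds (by linarith))
    exact h1.prod_nhds h2
  have hcomp : ∀ᶠ p : ℝ × ℝ in 𝓝 (x, q), ∀ c ∈ Icc 0 N,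
      ((F (max p.1 0) (max c 0) * p.2 : ℝ) : EReal) + u (max c 0) (max p.1 0) < (h : EReal) := by
    refine isCompact_Icc.eventually_forall_of_forall_eventually fun c hc => ?_
    have c1 : Continuous fun z : (ℝ × ℝ) × ℝ =>
        ((F (max z.1.1 0) (max z.2 0) * z.1.2 : ℝ) : EReal) := by
      refine continuous_coe_real_ereal.comp (Continuous.mul ?_ (by fun_prop))
      exact m.F_cont.comp (g := fun p : ℝ × ℝ => F (max p.1 0) (max p.2 0))
        (f := fun z : (ℝ × ℝ) × ℝ => (z.1.1, z.2)) (by fun_prop)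
    have c2 : Continuous fun z : (ℝ × ℝ) × ℝ => u (max z.2 0) (max z.1.1 0) :=
      m.u_cont.comp (g := fun p : ℝ × ℝ => u (max p.1 0) (max p.2 0))
        (f := fun z : (ℝ × ℝ) × ℝ => (z.2, z.1.1)) (by fun_prop)
    have c3 : ContinuousAt (fun z : (ℝ × ℝ) × ℝ =>
        ((F (max z.1.1 0) (max z.2 0) * z.1.2 : ℝ) : EReal) + u (max z.2 0) (max z.1.1 0))
        ((x, q), c) := by
      refine ContinuousAt.comp₂ (f := fun a : EReal × EReal => a.1 + a.2)
        (EReal.continuousAt_add ?_ ?_) c1.continuousAt c2.continuousAt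
      · exact Or.inl (EReal.coe_ne_top _)
      · exact Or.inl (EReal.coe_ne_bot _)
    refine c3.eventually (gt_mem_nhds ?_)
    simpa [max_eq_left hx.le, max_eq_left hc.1] using hlt c hc.1
  filter_upwards [hpos, hcomp] with p hp hpc c hc
  rcases le_or_gt c N with hcN | hcN
  · have := hpc c ⟨hc, hcN⟩
    rw [max_eq_left hp.1.1.le, max_eq_left hc] at this
    exact this.le
  · have h1 : (R - h) / (q * δ / 4) < c := (le_max_right _ _).trans_lt hcN
    rw [div_lt_iff₀ (by positivity)] at h1
    refine (add_le_add_right (m.u_le c p.1 hc hp.1.1.le) _).trans ?_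
    rw [← EReal.coe_add, EReal.coe_le_coe_iff]
    have h2 := m.F_le p.1 c hp.1.1.le hc
    have h3 : p.1 ^ σ ≤ (2 * x) ^ σ := Real.rpow_le_rpow hp.1.1.le hp.1.2.le m.σ_pos.le
    have h4 := hD c hc
    have h5 : F p.1 c * p.2 ≤ (γ * p.1 + B - δ * c) * p.2 :=
      mul_le_mul_of_nonneg_right h2 (by linarith [hp.2.1])
    have h6 : (γ * p.1 + B) * p.2 ≤ (γ * (2 * x) + B) * (2 * q) :=
      mul_le_mul (by nlinarith [hp.1.2]) hp.2.2.le (by linarith [hp.2.1]) (by positivity)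
    have h7 : δ * c * (q / 2) ≤ δ * c * p.2 :=
      mul_le_mul_of_nonneg_left hp.2.1.le (by positivity)
    have h8 : A * (1 + c ^ σ + p.1 ^ σ) ≤ A * (1 + (D + τ * c) + (2 * x) ^ σ) :=
      mul_le_mul_of_nonneg_left (by linarith) hA
    have h9 : A * τ * c ≤ q * δ / 4 * c := mul_le_mul_of_nonneg_right hAτ hc
    nlinarith

theorem integrableOn_comp_add {g : ℝ → ℝ} {a : ℝ} (hg : IntegrableOn g (Ici a)) :
    IntegrableOn (fun t => g (a + t)) (Ici 0) ∧
      ∫ t in Ici 0, g (a + t) = ∫ t in Ici a, g t := by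
  have hmp := measurePreserving_add_left (volume : Measure ℝ) a
  have hemb : MeasurableEmbedding fun t : ℝ => a + t :=
    (MeasurableEquiv.addLeft a).measurableEmbedding
  have hpre : (fun t : ℝ => a + t) ⁻¹' Ici a = Ici 0 := by
    ext t
    simp
  rw [← hpre]
  exact ⟨(hmp.integrableOn_comp_preimage hemb).2 hg, hmp.setIntegral_preimage_emb hemb g (Ici a)⟩

theorem ae_Ici_comp_add {P : ℝ → Prop} (h : ∀ᵐ t ∂(volume.restrict (Ici (0 : ℝ))), P t) {a : ℝ}
    (ha : 0 ≤ a) : ∀ᵐ t ∂(volume.restrict (Ici (0 : ℝ))), P (a + t) := by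
  rw [ae_restrict_iff' measurableSet_Ici] at h ⊢
  have := (measurePreserving_add_left (volume : Measure ℝ) a).quasiMeasurePreserving.ae h
  filter_upwards [this] with t ht ht0
  exact ht (add_nonneg ha ht0)

/-- The dynamic programming inequality: the payoff after `T` is at most the discounted value of the
stock at `T`. -/
theorem Model.integral_Ioi_le (m : Model ρ W u F γ δ B d σ A) {k c g : ℝ → ℝ} {x : ℝ}
    (htr : IsTrajectory F k c x) (hc : c ∈ W) (hg : IntegrableOn g (Ici 0))
    (hd : ∀ᵐ t ∂(volume.restrict (Ici (0 : ℝ))), discounted ρ u k c t = (g t : EReal))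
    {T : ℝ} (hT : 0 ≤ T) (hkT : 0 < k T) :
    ∫ t in Ioi T, g t ≤ Real.exp (-ρ * T) * realValue ρ W u F (k T) := by
  have s := m.isSubpath htr hc
  have hsub : IsSubpath W F (fun t => k (T + t)) (fun t => c (T + t))
      (fun t => F (k (T + t)) (c (T + t))) (k T) := by
    refine ⟨s.rate.shift hT, fun t ht => s.k_nonneg _ (add_nonneg hT ht),
      fun t ht => s.c_nonneg _ (add_nonneg hT ht), Eventually.of_forall fun _ => le_rfl,
      s.bdd.imp_right fun h S hS => ?_⟩
    obtain ⟨M, hM⟩ := h (T + S) (add_nonneg hT hS)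
    refine ⟨M, ?_⟩
    rw [ae_restrict_iff' measurableSet_Icc] at hM ⊢
    have := (measurePreserving_add_left (volume : Measure ℝ) T).quasiMeasurePreserving.ae hM
    filter_upwards [this] with t ht ht0
    exact ht ⟨by linarith [ht0.1], by linarith [ht0.2]⟩
  obtain ⟨i, e⟩ := integrableOn_comp_add (hg.mono_set (Ici_subset_Ici.2 hT))
  have hle := m.integral_le_realValue hkT hsub (g := fun t => Real.exp (ρ * T) * g (T + t))
    (i.const_mul _) (by
      filter_upwards [ae_Ici_comp_add hd hT] with t ht
      refine coe_le_discounted_of_exp ?_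
      rw [eq_coe_of_discounted ht, EReal.coe_le_coe_iff, ← mul_assoc, ← Real.exp_add]
      refine le_of_eq ?_
      congr 2
      ring)
  rw [integral_const_mul, e, integral_Ici_eq_integral_Ioi] at hle
  have := mul_le_mul_of_nonneg_left hle (Real.exp_pos (-ρ * T)).le
  rwa [← mul_assoc, ← Real.exp_add, show -ρ * T + ρ * T = 0 by ring, Real.exp_zero, one_mul] at this

/-- A continuous path stays within distance `r` of its origin up to time `T₀`, or there is a first
time at which it is at distance `r`. -/
theorem exists_stopping_time {k : ℝ → ℝ} (hk : ContinuousOn k (Ici 0)) {r T₀ : ℝ} (hr : 0 < r)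
    (hT₀ : 0 < T₀) : ∃ T, 0 < T ∧ T ≤ T₀ ∧ (∀ t, 0 ≤ t → t ≤ T → |k t - k 0| ≤ r) ∧
      (T = T₀ ∨ |k T - k 0| = r) := by
  have hcont : ContinuousOn (fun t => |k t - k 0|) (Icc 0 T₀) :=
    ((hk.mono Icc_subset_Ici_self).sub continuousOn_const).abs
  set S : Set ℝ := Icc 0 T₀ ∩ (fun t => |k t - k 0|) ⁻¹' Ici r with hS
  rcases S.eq_empty_or_nonempty with hemp | hne
  · refine ⟨T₀, hT₀, le_rfl, fun t ht htT => ?_, Or.inl rfl⟩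
    by_contra hlt
    have : t ∈ S := ⟨⟨ht, htT⟩, (not_le.1 hlt).le⟩
    rw [hemp] at this
    exact this
  · have hcl : IsClosed S := hcont.preimage_isClosed_of_isClosed isClosed_Icc isClosed_Ici
    obtain ⟨T, hTS, hleast⟩ :=
      (isCompact_Icc.of_isClosed_subset hcl inter_subset_left).exists_isLeast hne
    have hTr : r ≤ |k T - k 0| := hTS.2
    have hT0 : 0 < T := by
      refine lt_of_le_of_ne hTS.1.1 fun h => ?_
      rw [← h, sub_self, abs_zero] at hTr
      linarith
    have heq : |k T - k 0| = r := by
      refine le_antisymm (not_lt.1 fun hlt => ?_) hTr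
      obtain ⟨s, hs, hsr⟩ := intermediate_value_Icc hTS.1.1
        (hcont.mono (Icc_subset_Icc_right hTS.1.2))
        (show r ∈ Icc |k 0 - k 0| |k T - k 0| by simpa using ⟨hr.le, hlt.le⟩)
      have hsS : s ∈ S := ⟨⟨hs.1, hs.2.trans hTS.1.2⟩, hsr.ge⟩
      have : s = T := le_antisymm hs.2 (hleast hsS)
      rw [this] at hsr
      simp only at hsr
      linarith
    refine ⟨T, hT0, hTS.1.2, fun t ht htT => ?_, Or.inr heq⟩
    rcases htT.eq_or_lt with rfl | hlt
    · exact heq.le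
    · by_contra hgt
      exact not_le.2 hlt (hleast ⟨⟨ht, htT.trans hTS.1.2⟩, (not_le.1 hgt).le⟩)

/-- If the Hamiltonian is at most `ρ V(x) - ε` at slope `q'` for all stocks within `r` of `x`, then
a path that stays there until `T` loses at least `ε / 2` per unit of discounted time, up to the
difference between the slope `q` of the tangent of `V` and `q'`. -/
theorem Model.integral_le_of_hamiltonian_le (m : Model ρ W u F γ δ B d σ A) {k c g : ℝ → ℝ}
    {x q q' r ε T : ℝ} (htr : IsTrajectory F k c x) (hc : c ∈ W)
    (hg : IntegrableOn g (Ici 0))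
    (hd : ∀ᵐ t ∂(volume.restrict (Ici (0 : ℝ))), discounted ρ u k c t = (g t : EReal))
    (hT : 0 < T) (hrx : r < x) (hq' : 0 ≤ q') (hr : ρ * q' * r ≤ ε / 2)
    (htan : ∀ y, 0 < y → realValue ρ W u F y ≤ realValue ρ W u F x + q * (y - x))
    (hH : ∀ y, |y - x| ≤ r → ∀ c, 0 ≤ c →
      ((F y c * q' : ℝ) : EReal) + u c y ≤ ((ρ * realValue ρ W u F x - ε : ℝ) : EReal))
    (hk : ∀ t, 0 ≤ t → t ≤ T → |k t - x| ≤ r) :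
    ∫ t in Ici 0, g t ≤ realValue ρ W u F x - ε / 2 * ((1 - Real.exp (-ρ * T)) / ρ) +
      Real.exp (-ρ * T) * ((q - q') * (k T - x)) := by
  have hρ := m.control.rho_pos
  set v := realValue ρ W u F x with hv
  have hkT : 0 < k T := by linarith [(abs_le.1 (hk T hT.le le_rfl)).1]
  have hun : Ici (0 : ℝ) = Icc 0 T ∪ Ioi T := (Icc_union_Ioi_eq_Ici hT.le).symm
  have hdisj : Disjoint (Icc (0 : ℝ) T) (Ioi T) :=
    Set.disjoint_left.2 fun t ht ht' => not_lt.2 ht.2 ht'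
  have hsum : ∫ t in Ici 0, g t = (∫ t in Icc (0 : ℝ) T, g t) + ∫ t in Ioi T, g t := by
    rw [hun, setIntegral_union hdisj measurableSet_Ioi (hg.mono_set Icc_subset_Ici_self)
      (hg.mono_set (Ioi_subset_Ici hT.le))]
  have htail := (m.integral_Ioi_le htr hc hg hd hT.le hkT).trans
    (mul_le_mul_of_nonneg_left (htan _ hkT) (Real.exp_pos (-ρ * T)).le)
  have hrate := htr.hasRate.exp_mul ρ
  have hrT := hrate.integrable T hT.le
  have j1 : IntervalIntegrable (fun t => Real.exp (-ρ * t) * (ρ * v - ε / 2 - q' * ρ * x))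
      volume 0 T :=
    (by fun_prop : Continuous fun t => Real.exp (-ρ * t) *
      (ρ * v - ε / 2 - q' * ρ * x)).intervalIntegrable _ _
  have hhead : ∫ t in Icc (0 : ℝ) T, g t ≤ (ρ * v - ε / 2 - q' * ρ * x) *
      ((1 - Real.exp (-ρ * T)) / ρ) - q' * (Real.exp (-ρ * T) * k T - x) := by
    calc ∫ t in Icc (0 : ℝ) T, g t
        ≤ ∫ t in Icc (0 : ℝ) T, (Real.exp (-ρ * t) * (ρ * v - ε / 2 - q' * ρ * x) -
            q' * (Real.exp (-ρ * t) * (F (k t) (c t) - ρ * k t))) := by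
          refine setIntegral_mono_ae_restrict (hg.mono_set Icc_subset_Ici_self)
            ((intervalIntegrable_iff_integrableOn_Icc_of_le hT.le).1
              (j1.sub (hrT.const_mul q'))) ?_
          filter_upwards [ae_restrict_of_ae_restrict_of_subset Icc_subset_Ici_self hd,
            ae_restrict_mem measurableSet_Icc] with t h1 h2
          have h3 := hH (k t) (hk t h2.1 h2.2) (c t) (m.control.nonneg hc h2.1)
          rw [eq_coe_of_discounted h1, ← EReal.coe_add, EReal.coe_le_coe_iff] at h3
          have h4 := mul_le_mul_of_nonneg_left h3 (Real.exp_pos (-ρ * t)).le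
          rw [mul_add, ← mul_assoc (Real.exp (-ρ * t)) (Real.exp (ρ * t)), ← Real.exp_add,
            show -ρ * t + ρ * t = 0 by ring, Real.exp_zero, one_mul] at h4
          have h5 : q' * ρ * (x - k t) ≤ ε / 2 := by
            refine le_trans ?_ hr
            rw [mul_comm q' ρ]
            exact mul_le_mul_of_nonneg_left (by linarith [(abs_le.1 (hk t h2.1 h2.2)).1])
              (by positivity)
          have h6 := mul_le_mul_of_nonneg_left h5 (Real.exp_pos (-ρ * t)).le
          linarith
      _ = _ := by
          rw [integral_Icc_eq_integral_Ioc, ← intervalIntegral.integral_of_le hT.le,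
            intervalIntegral.integral_sub j1 (hrT.const_mul q'),
            intervalIntegral.integral_mul_const, integral_exp_neg hρ.ne',
            intervalIntegral.integral_const_mul, ← hrate.sub_eq le_rfl hT.le, htr.initial]
          simp only [mul_zero, Real.exp_zero, one_mul]
          ring
  have hm : ρ * ((1 - Real.exp (-ρ * T)) / ρ) = 1 - Real.exp (-ρ * T) := by field_simp
  rw [hsum]
  have e1 : (ρ * v - ε / 2 - q' * ρ * x) * ((1 - Real.exp (-ρ * T)) / ρ) =
      (v - q' * x) * (1 - Real.exp (-ρ * T)) - ε / 2 * ((1 - Real.exp (-ρ * T)) / ρ) := by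
    field_simp
    ring
  rw [e1] at hhead
  linarith

theorem Model.isViscositySupersolution (m : Model ρ W u F γ δ B d σ A) :
    IsViscositySupersolution ρ u F (realValue ρ W u F) := by
  refine ⟨m.continuousOn_realValue.lowerSemicontinuousOn, fun x hx U φ hU hxU hU0 hφ hφx hle => ?_⟩
  have hρ := m.control.rho_pos
  have hγ := m.γ_pos
  have hB := m.B_nonneg
  have hd : HasDerivAt φ (deriv φ x) x :=
    ((hφ.differentiableOn one_ne_zero).differentiableAt (hU.mem_nhds hxU)).hasDerivAt
  set q := deriv φ x with hq
  set v := realValue ρ W u F x with hv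
  have htan : ∀ y, 0 < y → realValue ρ W u F y ≤ v + q * (y - x) := fun y hy =>
    concaveOn_le_tangent m.concaveOn_realValue hx hy hd hφx (Filter.mem_of_superset (hU.mem_nhds hxU) hle)
  have hq0 : 0 < q := by
    have h1 := htan (x + 1) (by linarith)
    have h2 := m.strictMonoOn_realValue hx (show 0 < x + 1 by linarith) (by linarith)
    linarith
  rw [ge_iff_le, EReal.sub_nonneg (Or.inr (EReal.coe_ne_top _)) (Or.inr (EReal.coe_ne_bot _))]
  by_contra hlt
  obtain ⟨h, hh1, hh2⟩ := EReal.lt_iff_exists_real_btwn.1 (not_le.1 hlt)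
  rw [EReal.coe_lt_coe_iff] at hh2
  set ε := ρ * v - h with hε
  have hε0 : 0 < ε := by linarith
  have hev := m.eventually_hamiltonian_le hx hq0 (h := h) fun c hc =>
    (le_iSup₂ (f := fun (c : ℝ) (_ : 0 ≤ c) => ((F x c * q : ℝ) : EReal) + u c x) c hc).trans_lt hh1
  obtain ⟨r₀, hr₀, hball⟩ := Metric.eventually_nhds_iff.1 hev
  -- `C` bounds the growth of the stock below `2 x`; `η` is the reduction of the slope.
  set C := γ * (2 * x) + B with hC
  have hC0 : 0 < C := by positivity
  set η := min (r₀ / 2) (min (q / 2) (ε / (4 * C))) with hη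
  have hη0 : 0 < η := by positivity
  have hη1 : η ≤ r₀ / 2 := min_le_left _ _
  have hη2 : η ≤ q / 2 := (min_le_right _ _).trans (min_le_left _ _)
  have hη3 : η * C ≤ ε / 4 := by
    have : η ≤ ε / (4 * C) := (min_le_right _ _).trans (min_le_right _ _)
    rw [le_div_iff₀ (by positivity)] at this
    linarith
  set r := min (r₀ / 2) (min (x / 2) (ε / (2 * (ρ * q)))) with hr
  have hr0 : 0 < r := by positivity
  have hr1 : r ≤ r₀ / 2 := min_le_left _ _
  have hr2 : r ≤ x / 2 := (min_le_right _ _).trans (min_le_left _ _)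
  have hr3 : ρ * (q - η) * r ≤ ε / 2 := by
    have h1 : r ≤ ε / (2 * (ρ * q)) := (min_le_right _ _).trans (min_le_right _ _)
    rw [le_div_iff₀ (by positivity)] at h1
    have h2 : 0 < ρ * η * r := by positivity
    nlinarith
  set T₀ := r / (2 * C) with hT₀
  have hT₀0 : 0 < T₀ := by positivity
  have hT₀r : C * T₀ < r := by
    have : C * T₀ = r / 2 := by rw [hT₀]; field_simp
    linarith
  have hH : ∀ y, |y - x| ≤ r → ∀ c, 0 ≤ c →
      ((F y c * (q - η) : ℝ) : EReal) + u c y ≤ ((ρ * v - ε : ℝ) : EReal) := by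
    intro y hy c hc
    have : ((ρ * v - ε : ℝ) : EReal) = h := by rw [hε, sub_sub_cancel]
    rw [this]
    refine hball (y := (y, q - η)) ?_ c hc
    rw [Prod.dist_eq, max_lt_iff, Real.dist_eq, Real.dist_eq, sub_sub_cancel_left, abs_neg,
      abs_of_pos hη0]
    exact ⟨by linarith, by linarith⟩
  set κ := min (ε / 4 * (Real.exp (-ρ * T₀) * T₀)) (Real.exp (-ρ * T₀) * (η * r)) with hκ
  have hκ0 : 0 < κ := by positivity
  obtain ⟨k, c, hc, g, htr, hg, hdg, hV⟩ := m.exists_near_optimal hx hκ0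
  have hcont := htr.hasRate.continuousOn
  obtain ⟨T, hT0, hTT₀, hkr, hexit⟩ := exists_stopping_time hcont hr0 hT₀0
  rw [htr.initial] at hexit
  have hkr : ∀ t, 0 ≤ t → t ≤ T → |k t - x| ≤ r := fun t h1 h2 => by
    simpa [htr.initial] using hkr t h1 h2
  have hmain := m.integral_le_of_hamiltonian_le htr hc hg hdg hT0 (by linarith) (by linarith) hr3
    htan hH hkr
  rw [sub_sub_cancel, ← hv] at hmain
  have hgrow : k T - x ≤ C * T := by
    have := htr.hasRate.sub_le_integral (g := fun _ => C) le_rfl hT0.le intervalIntegrable_const (by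
      filter_upwards [ae_restrict_mem measurableSet_Ioc] with t ht
      have h1 := m.F_le (k t) (c t) (htr.nonneg t ht.1.le) (m.control.nonneg hc ht.1.le)
      have h2 : k t ≤ 2 * x := by linarith [(abs_le.1 (hkr t ht.1.le ht.2)).2]
      have h3 := mul_nonneg m.δ_pos.le (m.control.nonneg hc ht.1.le)
      have h4 := mul_le_mul_of_nonneg_left h2 hγ.le
      linarith)
    rw [htr.initial] at this
    simpa [mul_comm] using this
  have he0 := Real.exp_pos (-ρ * T)
  have hm : T * Real.exp (-ρ * T) ≤ (1 - Real.exp (-ρ * T)) / ρ := by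
    rw [le_div_iff₀ hρ]
    have h1 := Real.add_one_le_exp (ρ * T)
    have h2 := mul_le_mul_of_nonneg_right h1 he0.le
    rw [← Real.exp_add, show ρ * T + -ρ * T = 0 by ring, Real.exp_zero] at h2
    linarith
  have hbound : ∫ t in Ici 0, g t ≤ v - κ := by
    rcases hexit with hT | hT
    · have h1 : η * (k T - x) ≤ ε / 4 * T := by
        have := mul_le_mul_of_nonneg_left hgrow hη0.le
        have := mul_le_mul_of_nonneg_right hη3 hT0.le
        linarith
      have h2 := mul_le_mul_of_nonneg_left h1 he0.le
      have h3 := mul_le_mul_of_nonneg_left hm (by positivity : 0 ≤ ε / 2)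
      have h4 : κ ≤ ε / 4 * (Real.exp (-ρ * T) * T) := by
        rw [hT]
        exact min_le_left _ _
      linarith
    · have h1 : k T - x = -r := by
        rcases abs_eq hr0.le |>.1 hT with h | h
        · have := mul_le_mul_of_nonneg_left hTT₀ hC0.le
          linarith
        · exact h
      rw [h1] at hmain
      have h2 : Real.exp (-ρ * T₀) ≤ Real.exp (-ρ * T) := Real.exp_le_exp.2 (by nlinarith)
      have h3 := mul_le_mul_of_nonneg_right h2 (by positivity : 0 ≤ η * r)
      have h4 : κ ≤ Real.exp (-ρ * T₀) * (η * r) := min_le_right _ _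
      have h5 : 0 ≤ ε / 2 * ((1 - Real.exp (-ρ * T)) / ρ) :=
        mul_nonneg (by positivity) ((by positivity : 0 ≤ T * Real.exp (-ρ * T)).trans hm)
      linarith
  linarith

/-! ### Pure accumulation paths and the growth condition -/

/-- A path that does not decrease while it is below `b` stays above `b`. -/
theorem HasRate.le_of_barrier {k f : ℝ → ℝ} {x b : ℝ} (h : HasRate k f x) (hb : b ≤ x)
    (hf : ∀ᵐ t ∂(volume.restrict (Ici (0 : ℝ))), k t < b → 0 ≤ f t) {t : ℝ} (ht : 0 ≤ t) :
    b ≤ k t := by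
  by_contra! hlt
  have hcont : ContinuousOn k (Icc 0 t) := h.continuousOn.mono Icc_subset_Ici_self
  have hcl : IsClosed (Icc 0 t ∩ k ⁻¹' Ici b) :=
    hcont.preimage_isClosed_of_isClosed isClosed_Icc isClosed_Ici
  obtain ⟨s, ⟨hs, hsb⟩, hgreat⟩ :=
    (isCompact_Icc.of_isClosed_subset hcl inter_subset_left).exists_isGreatest
      ⟨0, ⟨le_rfl, ht⟩, by simpa [h.zero] using hb⟩
  have hsb : b ≤ k s := hsb
  have : 0 ≤ ∫ y in s..t, f y := by
    refine intervalIntegral.integral_nonneg_of_ae_restrict hs.2 ?_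
    rw [← Measure.restrict_congr_set Ioc_ae_eq_Icc]
    filter_upwards [ae_restrict_of_ae_restrict_of_subset
      (fun y hy => hs.1.trans hy.1.le : Ioc s t ⊆ Ici 0) hf,
      ae_restrict_mem measurableSet_Ioc] with y h1 h2
    refine h1 (not_le.1 fun hby => ?_)
    exact not_le.2 h2.1 (hgreat ⟨⟨hs.1.trans h2.1.le, h2.2⟩, hby⟩)
  rw [← h.sub_eq hs.1 ht] at this
  linarith

/-- Global existence for a bounded Lipschitz vector field on the line. -/
theorem exists_global_solution {g : ℝ → ℝ} {K C : NNReal} (hg : LipschitzWith K g)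
    (hC : ∀ y, ‖g y‖ ≤ C) (y₀ : ℝ) : ∃ y : ℝ → ℝ, y 0 = y₀ ∧ ∀ t, HasDerivAt y (g (y t)) t := by
  have hloc : ∀ n : ℕ, ∃ α : ℝ → ℝ, α 0 = y₀ ∧
      ∀ t ∈ Ioo (-(n + 1 : ℝ)) (n + 1), HasDerivAt α (g (α t)) t := by
    intro n
    have h0 : (0 : ℝ) ∈ Icc (-(n + 1 : ℝ)) (n + 1) := ⟨by linarith [n.cast_nonneg (α := ℝ)],
      by positivity⟩
    have hP : IsPicardLindelof (fun _ => g) (⟨0, h0⟩ : Icc (-(n + 1 : ℝ)) (n + 1)) y₀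
        (C * (n + 1)) 0 C K :=
      IsPicardLindelof.of_time_independent (fun y _ => hC y) hg.lipschitzOnWith (by simp)
    obtain ⟨α, h1, h2⟩ := hP.exists_eq_forall_mem_Icc_hasDerivWithinAt₀
    exact ⟨α, h1, fun t ht => (h2 t (Ioo_subset_Icc_self ht)).hasDerivAt (Icc_mem_nhds ht.1 ht.2)⟩
  choose α hα0 hα using hloc
  have huniq : ∀ n m : ℕ, n ≤ m → ∀ s ∈ Ioo (-(n + 1 : ℝ)) (n + 1), α n s = α m s := by
    intro n m hnm
    have hnm' : (n : ℝ) ≤ m := by exact_mod_cast hnm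
    have h0 : (0 : ℝ) ∈ Ioo (-(n + 1 : ℝ)) (n + 1) := ⟨by linarith [n.cast_nonneg (α := ℝ)],
      by positivity⟩
    exact ODE_solution_unique_of_mem_Ioo (v := fun _ => g) (s := fun _ => univ) (K := K)
      (fun _ _ => hg.lipschitzOnWith) h0 (fun t ht => ⟨hα n t ht, mem_univ _⟩)
      (fun t ht => ⟨hα m t ⟨by linarith [ht.1], by linarith [ht.2]⟩, mem_univ _⟩)
      ((hα0 n).trans (hα0 m).symm)
  have huniq' : ∀ (n m : ℕ) (s : ℝ), |s| < n + 1 → |s| < m + 1 → α n s = α m s := by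
    intro n m s hn hm
    rcases le_total n m with h | h
    · exact huniq n m h s (abs_lt.1 hn)
    · exact (huniq m n h s (abs_lt.1 hm)).symm
  refine ⟨fun t => α ⌈|t|⌉₊ t, by simp [hα0], fun t => ?_⟩
  have hceil : ∀ s : ℝ, |s| < (⌈|s|⌉₊ : ℝ) + 1 := fun s => by linarith [Nat.le_ceil |s|]
  refine (hα ⌈|t|⌉₊ t (abs_lt.1 (hceil t))).congr_of_eventuallyEq ?_
  filter_upwards [continuous_abs.continuousAt.eventually (gt_mem_nhds (hceil t))] with s hs
  exact huniq' _ _ s (hceil s) hs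

theorem Model.zero_mem (m : Model ρ W u F γ δ B d σ A) : (fun _ : ℝ => (0 : ℝ)) ∈ W := by
  rcases m.control.controls with rfl | rfl
  · exact ⟨fun _ _ => le_rfl, (locallyIntegrable_const 0).locallyIntegrableOn _⟩
  · exact ⟨fun _ _ => le_rfl, aemeasurable_const, fun _ _ => ⟨0, fun _ _ => le_rfl⟩⟩

theorem Model.exists_pureAccumulationPath (m : Model ρ W u F γ δ B d σ A) {x : ℝ} (hx : 0 < x) :
    ∃ κ, IsPureAccumulationPath F x κ := by
  obtain ⟨k₀, hk₀, hpos⟩ := m.tech.exists_pos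
  set b := min k₀ x with hb
  have hb0 : 0 < b := lt_min hk₀ hx
  have hbx : b ≤ x := min_le_right _ _
  have hFb := hpos b hb0 (min_le_left _ _)
  have hd := m.d_pos
  have hγ := m.γ_pos
  have hB := m.B_nonneg
  set L := γ + B / b with hL
  have hL0 : 0 < L := by positivity
  -- In logarithmic coordinates the vector field is bounded and Lipschitz on `[log b, ∞)`.
  set q : ℝ → ℝ := fun k => F k 0 / k with hq
  have hq1 : ∀ k, b ≤ k → q k ≤ L := by
    intro k hk
    have hk0 : 0 < k := hb0.trans_le hk
    have h1 := m.F_le k 0 hk0.le le_rfl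
    have h2 : B / k ≤ B / b := by gcongr
    simp only [hq]
    rw [div_le_iff₀ hk0]
    have h3 : B = B / k * k := by field_simp
    nlinarith
  have hq2 : ∀ k, 0 < k → -d ≤ q k := by
    intro k hk0
    have h1 := m.F_slope 0 k 0 le_rfl hk0.le le_rfl
    rw [m.tech.zero, zero_add] at h1
    simp only [hq]
    rw [le_div_iff₀ hk0]
    linarith
  have hq3 : ∀ k k', 0 < k → k ≤ k' → q k' ≤ q k := by
    intro k k' hk hkk
    have hk' := hk.trans_le hkk
    have := m.tech.concave_coord (k := k') (c := 0) (k' := 0) (c' := 0) hk'.le le_rfl le_rfl le_rfl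
      (div_nonneg hk.le hk'.le) (sub_nonneg.2 ((div_le_one hk').2 hkk)) (add_sub_cancel (k / k') 1)
    rw [m.tech.zero] at this
    simp only [mul_zero, add_zero, div_mul_cancel₀ _ hk'.ne'] at this
    simp only [hq]
    rw [div_le_div_iff₀ hk' hk]
    rw [div_mul_eq_mul_div, div_le_iff₀ hk'] at this
    linarith
  have hq4 : ∀ y y', y ≤ y' → b ≤ Real.exp y →
      q (Real.exp y) - q (Real.exp y') ≤ (L + d) * (y' - y) := by
    intro y y' hyy hby
    set k := Real.exp y with hk
    set k' := Real.exp y' with hk'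
    have hk0 : 0 < k := Real.exp_pos _
    have hk0' : 0 < k' := Real.exp_pos _
    have hkk : k ≤ k' := Real.exp_le_exp.2 hyy
    have h1 := m.F_slope k (k' - k) 0 hk0.le (sub_nonneg.2 hkk) le_rfl
    rw [add_sub_cancel] at h1
    have e : q k - (F k 0 - d * (k' - k)) / k' = (q k + d) * (1 - k / k') := by
      simp only [hq]
      field_simp
      ring
    have h2 : (F k 0 - d * (k' - k)) / k' ≤ q k' := by
      simp only [hq]
      gcongr
    have h3 : 1 - k / k' ≤ y' - y := by
      rw [hk, hk', ← Real.exp_sub]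
      linarith [Real.add_one_le_exp (y - y')]
    have h4 : 0 ≤ 1 - k / k' := sub_nonneg.2 ((div_le_one hk0').2 hkk)
    have h5 := hq1 k hby
    have h6 := hq2 k hk0
    nlinarith
  set G : ℝ → ℝ := fun y => q (Real.exp (max y (Real.log b))) with hG
  have hbG : ∀ y, b ≤ Real.exp (max y (Real.log b)) := fun y => by
    rw [← Real.log_le_iff_le_exp hb0]
    exact le_max_right _ _
  have hGlip : LipschitzWith (L + d).toNNReal G := by
    refine LipschitzWith.of_dist_le_mul fun y y' => ?_
    rw [Real.coe_toNNReal _ (by positivity)]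
    wlog hyy : y ≤ y' generalizing y y'
    · rw [dist_comm, dist_comm y y']
      exact this y' y (le_of_not_ge hyy)
    have hmax : max y (Real.log b) ≤ max y' (Real.log b) := max_le_max_right _ hyy
    have h1 := hq4 _ _ hmax (hbG y)
    have h2 := hq3 _ _ (Real.exp_pos _) (Real.exp_le_exp.2 hmax)
    have h3 : max y' (Real.log b) - max y (Real.log b) ≤ y' - y := by
      rcases max_cases y' (Real.log b) with ⟨h, _⟩ | ⟨h, _⟩ <;>
        rcases max_cases y (Real.log b) with ⟨h', _⟩ | ⟨h', _⟩ <;> rw [h, h'] <;> linarith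
    rw [Real.dist_eq, Real.dist_eq, abs_sub_comm y y', abs_of_nonneg (sub_nonneg.2 h2),
      abs_of_nonneg (sub_nonneg.2 hyy)]
    exact h1.trans (mul_le_mul_of_nonneg_left h3 (by positivity))
  have hGb : ∀ y, ‖G y‖ ≤ (L + d).toNNReal := by
    intro y
    rw [Real.coe_toNNReal _ (by positivity), Real.norm_eq_abs, abs_le]
    have h1 := hq1 _ (hbG y)
    have h2 := hq2 _ (hb0.trans_le (hbG y))
    exact ⟨by simp only [hG]; linarith, by simp only [hG]; linarith⟩
  obtain ⟨y, hy0, hy⟩ := exists_global_solution hGlip hGb (Real.log x)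
  set κ : ℝ → ℝ := fun t => Real.exp (y t) with hκ
  have hyc : Continuous y := continuous_iff_continuousAt.2 fun t => (hy t).continuousAt
  have hrate : HasRate κ (fun t => κ t * G (y t)) x := by
    have h1 := HasRate.of_hasDerivAt (k := κ) (f := fun t => κ t * G (y t)) (fun t => (hy t).exp)
      ((Real.continuous_exp.comp hyc).mul (hGlip.continuous.comp hyc))
    have h2 : κ 0 = x := by
      simp only [hκ, hy0, Real.exp_log hx]
    rwa [h2] at h1
  have hκb : ∀ t, 0 ≤ t → b ≤ κ t := by
    intro t ht
    refine hrate.le_of_barrier hbx (Eventually.of_forall fun s hs => ?_) ht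
    have : y s < Real.log b := (Real.lt_log_iff_exp_lt hb0).2 hs
    simp only [hG, max_eq_right this.le, Real.exp_log hb0, hq]
    exact mul_nonneg (Real.exp_pos _).le (div_nonneg hFb.le hb0.le)
  refine ⟨κ, fun t _ => (Real.exp_pos _).le, fun a c ha hac => hrate.absolutelyContinuous ha hac,
    hrate.zero, ?_⟩
  filter_upwards [hrate.ae_hasDerivAt, ae_restrict_mem measurableSet_Ici] with t h1 h2
  have h3 : Real.log b ≤ y t := (Real.log_le_iff_le_exp hb0).2 (hκb t h2)
  convert! h1 using 1
  simp only [hG, max_eq_left h3, hq, hκ]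
  field_simp

theorem Model.growthCondition (m : Model ρ W u F γ δ B d σ A) :
    GrowthCondition ρ F (realValue ρ W u F) := by
  refine fun x hx => ⟨m.exists_pureAccumulationPath hx, fun κ hκ => ?_⟩
  have hρ := m.control.rho_pos
  have hγ := m.γ_pos
  have hδ := m.δ_pos
  have hB := m.B_nonneg
  have hA := m.A_nonneg
  have hη : 0 < ρ - σ * γ := sub_pos.2 m.σγ_lt
  obtain ⟨k₀, hk₀, hpos⟩ := m.tech.exists_pos
  set b := min k₀ x with hb
  have hb0 : 0 < b := lt_min hk₀ hx
  have htr : IsTrajectory F κ (fun _ => 0) x := hκ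
  have hlow : ∀ t, 0 ≤ t → b ≤ κ t := fun t ht =>
    htr.hasRate.le_of_barrier (min_le_right _ _) (by
      filter_upwards [ae_restrict_mem measurableSet_Ici] with s hs hsb
      rcases (htr.nonneg s hs).eq_or_lt with h | h
      · rw [← h, m.tech.zero]
      · exact (hpos _ h (hsb.le.trans (min_le_left _ _))).le) ht
  set K := x + B / γ with hK
  have hK0 : 0 < K := by positivity
  have hexp : ∀ {a : ℝ}, 0 < a → Tendsto (fun T : ℝ => Real.exp (-a * T)) atTop (𝓝 0) := by
    intro a ha
    refine Real.tendsto_exp_atBot.comp ?_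
    exact tendsto_id.const_mul_atTop_of_neg (neg_neg_of_pos ha)
  set D := 2 / (ρ - σ * γ) + 1 / δ with hD
  have hD0 : 0 < D := by positivity
  have hlim1 : Tendsto (fun T => Real.exp (-ρ * T) * realValue ρ W u F b) atTop (𝓝 0) := by
    simpa using (hexp hρ).mul_const (realValue ρ W u F b)
  have hlim2 : Tendsto (fun T => A / ρ * Real.exp (-ρ * T) +
      A * D * (2 * K) ^ σ * Real.exp (-(ρ - σ * γ) * T)) atTop (𝓝 0) := by
    simpa using ((hexp hρ).const_mul (A / ρ)).add ((hexp hη).const_mul (A * D * (2 * K) ^ σ))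
  refine tendsto_of_tendsto_of_tendsto_of_le_of_le' hlim1 hlim2 ?_ ?_
  · filter_upwards [eventually_ge_atTop 0] with T hT
    exact mul_le_mul_of_nonneg_left (m.monotoneOn_realValue hb0 (hb0.trans_le (hlow T hT)) (hlow T hT))
      (Real.exp_pos _).le
  · filter_upwards [eventually_ge_atTop 0] with T hT
    have hκ0 : 0 < κ T := hb0.trans_le (hlow T hT)
    have h1 : κ T + B / γ ≤ 2 * K * Real.exp (γ * T) := by
      have h2 := m.capital_le htr m.zero_mem hT
      have h3 : 1 ≤ Real.exp (γ * T) := Real.one_le_exp (by positivity)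
      have h4 : B / γ ≤ K := by linarith
      nlinarith
    have h5 : (κ T + B / γ) ^ σ ≤ (2 * K) ^ σ * Real.exp (σ * γ * T) := by
      refine (Real.rpow_le_rpow (by positivity) h1 m.σ_pos.le).trans (le_of_eq ?_)
      rw [Real.mul_rpow (by positivity) (Real.exp_pos _).le, ← Real.exp_mul]
      congr 2
      ring
    have h6 := mul_le_mul_of_nonneg_left ((m.realValue_le_bound hκ0).trans
      (mul_le_mul_of_nonneg_left (add_le_add_right (mul_le_mul_of_nonneg_left h5 hD0.le) _) hA))
      (Real.exp_pos (-ρ * T)).le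
    refine h6.trans (le_of_eq ?_)
    have h7 : Real.exp (-(ρ - σ * γ) * T) = Real.exp (-ρ * T) * Real.exp (σ * γ * T) := by
      rw [← Real.exp_add]
      congr 1
      ring
    rw [h7]
    ring

end CapitalModel

theorem theorem1 (ρ : ℝ) (W : Set (ℝ → ℝ)) (u : ℝ → ℝ → EReal) (F : ℝ → ℝ → ℝ)
    (h₁ : CapitalModel.ControlAssumption ρ W)
    (h₂ : CapitalModel.UtilityAssumption u)
    (h₃ : CapitalModel.TechnologyAssumption W F)
    (h₄ : CapitalModel.MarginalUtilityAssumption u)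
    (h₅ : CapitalModel.BoundAssumption ρ u F) :
    (∀ k, 0 < k → CapitalModel.valueFunction ρ W u F k ≠ ⊥ ∧
      CapitalModel.valueFunction ρ W u F k ≠ ⊤) ∧
    CapitalModel.MemClass ρ F (fun k => (CapitalModel.valueFunction ρ W u F k).toReal) ∧
    CapitalModel.IsViscositySolution ρ u F
      (fun k => (CapitalModel.valueFunction ρ W u F k).toReal) := by
  obtain ⟨γ, δ, B, d, σ, A, m⟩ := CapitalModel.exists_model h₁ h₂ h₃ h₅
  exact ⟨fun k hk => ⟨m.value_ne_bot hk, m.value_ne_top hk⟩,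
    ⟨m.strictMonoOn_realValue, m.concaveOn_realValue, m.growthCondition⟩,
    ⟨m.continuousOn_realValue, m.isViscositySubsolution, m.isViscositySupersolution⟩⟩
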